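/- Let $\Lambda$ be a ring, $\mathrm{Proj}\,\Lambda$ the category of projective $\Lambda$-modules, and $T$ a tilting complex over $\Lambda$: a bounded complex of finitely generated projective modules with $\mathrm{Hom}_{K(\mathrm{Proj}\,\Lambda)}(T,T[n])=0$ for $n\neq 0$ such that $\mathrm{add}\,T$ (the direct summands of finite direct sums of copies of $T$) generates $K^b(\mathrm{proj}\,\Lambda)$ as a triangulated category. Let $\mathrm{Sum}\,T\subset K(\mathrm{Proj}\,\Lambda)$ be the full subcategory of direct sums of copies of $T$. *The category $K_\eta$.* For an additive category $\mathcal A$, an object of $\mathrm{gr}\,\mathcal A$ is a $\mathbb Z$-graded object of $\mathcal A$; a morphism $X\to Y$ is a family $f=\{f_n\}_{n\ge 0}$ of homogeneous maps $f_n^j\colon X^j\to Y^{j+n}$, with $(gf)_n=\sum_{p+q=n}g_pf_q$. Put $X(1)^j=X^{j+1}$, $f(1)_n^j=f_n^{j+1}$, and let $\eta_X=\{0,\mathrm{id},0,\dots\}\colon X(1)\to X$. These extend to complexes. Chain maps $f,g\colon X\to Y$ over $\mathrm{gr}\,\mathcal A$ are $\eta$-homotopic if $f\eta_X$ and $g\eta_X$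 are homotopic. Let $\mathcal E_\eta$ be the class of conflations in $C(\mathrm{gr}\,\mathcal A)$ isomorphic to $V\to\mathrm{cone}(\varphi)\to U[1]$ for a chain map $\varphi\colon U\to V$ that factors through $\eta_V$. The category $K_\eta(\mathrm{gr}\,\mathcal A)$ is the stable category of $(C(\mathrm{gr}\,\mathcal A),\mathcal E_\eta)$, i.e. chain maps modulo those that factor through an $\mathcal E_\eta$-injective object; two chain maps agree in it if and only if they are $\eta$-homotopic. Its translation functor is $X\mapsto X(1)[1]$, and its triangles are those isomorphic to a standard triangle $X\xrightarrow{f}Y\to\mathrm{cone}(f\eta_X)\to X(1)[1]$ of a chain map $f$. (In $K(\mathrm{Sum}\,T)$ and in $K_\eta$ the same sign convention is used for the map from a cone to the shift.) *The operation $\Theta$.* An object $X$ of $C(\mathrm{Sum}\,T)$ consists of complexes $(X^{\bullet,j},\delta_0^{\bullet,j})$ in $\mathrm{Sum}\,T$, $j\in\mathbb Z$, and of homotopy classes of chain maps $X^{\bullet,j}\to X^{\bullet,j+1}$ with composites null-homotopic; let $\delta_1^{\bullet,j}$ be representatives of these classes. A lift of $X$ is a complex $\Theta(X)$ over $\mathrm{gr}\,\mathrm{Proj}\,\Lambda$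 with $\Theta(X)^{ij}=X^{i-j,j}$ and differential $\{d_n\}_{n\ge0}$ such that $d_0^{ij}=\delta_0^{i-j,j}$ and $d_1^{ij}=(-1)^i\delta_1^{i-j,j}$ for some representatives $\delta_1$. A lift of a morphism $\alpha\colon X\to Y$ of $C(\mathrm{Sum}\,T)$, relative to lifts $\Theta(X)$, $\Theta(Y)$, is a chain map $f=\{f_n\}_{n\ge 0}\colon\Theta(X)\to\Theta(Y)$ with $f_0^{ij}=\alpha^{i-j,j}$ for some chain maps $\alpha^{\bullet,j}$ representing the components of $\alpha$. **Proposition.** 1. Every object of $C(\mathrm{Sum}\,T)$ has a lift, for any choice of the representatives $\delta_1$; and every morphism has a lift, for any lifts of its source and target and any choice of the representatives $\alpha^{\bullet,j}$. 2. For fixed lifts of source and target, lifts of homotopic morphisms are $\eta$-homotopic; in particular the lift of a morphism is unique up to $\eta$-homotopy. 3. Let $\Theta$ be any choice of lifts of all objects and all morphisms. Then $X\mapsto\Theta(X)$, $\alpha\mapsto\Theta(\alpha)$ induces a well-defined functor $K(\mathrm{Sum}\,T)\to K_\eta(\mathrm{gr}\,\mathrm{Proj}\,\Lambda)$. This functor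 is additive, and there is a natural isomorphism $\xi_X\colon\Theta(X[1])\cong\Theta(X)(1)[1]$ with which it is a triangle functor: if $X\xrightarrow{u}Y\xrightarrow{v}Z\xrightarrow{w}X[1]$ is a triangle in $K(\mathrm{Sum}\,T)$, then $(\Theta(u),\Theta(v),\xi_X\Theta(w))$ is a triangle in $K_\eta(\mathrm{gr}\,\mathrm{Proj}\,\Lambda)$. 4. Moreover $\Theta$ sends standard triangles to standard triangles: for every $\alpha\colon X\to Y$ in $C(\mathrm{Sum}\,T)$ there is an isomorphism $\Theta(\mathrm{cone}(\alpha))\cong\mathrm{cone}(\Theta(\alpha)\eta_{\Theta(X)})$ in $K_\eta(\mathrm{gr}\,\mathrm{Proj}\,\Lambda)$ which together with the identities of $\Theta(X)$ and $\Theta(Y)$ and with $\xi_X$ is an isomorphism from the image of the standard triangle of $\alpha$ to the standard triangle of $\Theta(\alpha)$. -/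

import Mathlib

open CategoryTheory Limits ZeroObject
open CochainComplex (mappingCone)

universe w v u

namespace RickardTheta

noncomputable section

section GradedCategory

variable (A : Type u)

/-- A `ℤ`-graded object of `A`, as an object of the category `gr A`. -/
structure Gr where
  obj : ℤ → A

variable {A} [Category.{v} A] [Preadditive A]

/-- A morphism `X ⟶ Y` of `gr A`: the component `f_n` of degree `n ≥ 0` at `X^i` is
`app i (i + n) : X^i ⟶ Y^(i + n)`; there are no components of negative degree. -/
@[ext]
structure Gr.Hom (X Y : Gr A) where
  app : ∀ i j : ℤ, X.obj i ⟶ Y.obj j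
  app_eq_zero : ∀ i j : ℤ, j < i → app i j = 0

namespace Gr

/-- The composition `(g f)_n = g_n f_0 + g_{n-1} f_1 + ⋯ + g_0 f_n`. -/
def Hom.comp {X Y Z : Gr A} (f : Hom X Y) (g : Hom Y Z) : Hom X Z where
  app i j := ∑ k ∈ Finset.Icc i j, f.app i k ≫ g.app k j
  app_eq_zero i j h := by
    rw [Finset.Icc_eq_empty (by omega), Finset.sum_empty]

/-- The morphism concentrated in degree `0` with components `φ i`. -/
def Hom.deg0 {X Y : Gr A} (φ : ∀ i, X.obj i ⟶ Y.obj i) : Hom X Y where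
  app i j := if h : i = j then φ i ≫ eqToHom (by rw [h]) else 0
  app_eq_zero i j h := dif_neg (by omega)

lemma Hom.comp_app_of_le {X Y Z : Gr A} (f : Hom X Y) (g : Hom Y Z) {i j a b : ℤ}
    (ha : a ≤ i) (hb : j ≤ b) :
    (f.comp g).app i j = ∑ k ∈ Finset.Icc a b, f.app i k ≫ g.app k j := by
  refine Finset.sum_subset (Finset.Icc_subset_Icc ha hb) (fun k _ hk => ?_)
  simp only [Finset.mem_Icc, not_and_or, not_le] at hk
  rcases hk with hk | hk
  · rw [f.app_eq_zero _ _ hk, zero_comp]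
  · rw [g.app_eq_zero _ _ hk, comp_zero]

lemma Hom.deg0_app_self {X Y : Gr A} (φ : ∀ i, X.obj i ⟶ Y.obj i) (i : ℤ) :
    (deg0 φ).app i i = φ i := by simp [deg0]

lemma Hom.deg0_app_ne {X Y : Gr A} (φ : ∀ i, X.obj i ⟶ Y.obj i) {i j : ℤ} (h : i ≠ j) :
    (deg0 φ).app i j = 0 := by simp [deg0, h]

lemma Hom.deg0_comp_app {X Y Z : Gr A} (φ : ∀ i, X.obj i ⟶ Y.obj i) (g : Hom Y Z) (i j : ℤ) :
    ((deg0 φ).comp g).app i j = φ i ≫ g.app i j := by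
  by_cases h : i ≤ j
  · change ∑ k ∈ Finset.Icc i j, _ = _
    rw [Finset.sum_eq_single i (fun k _ hk => by rw [deg0_app_ne _ hk.symm, zero_comp])
      (fun hi => (hi (by simp [h])).elim), deg0_app_self]
  · rw [Hom.app_eq_zero _ _ _ (by omega), g.app_eq_zero _ _ (by omega), comp_zero]

lemma Hom.comp_deg0_app {X Y Z : Gr A} (f : Hom X Y) (φ : ∀ i, Y.obj i ⟶ Z.obj i) (i j : ℤ) :
    (f.comp (deg0 φ)).app i j = f.app i j ≫ φ j := by
  by_cases h : i ≤ j
  · change ∑ k ∈ Finset.Icc i j, _ = _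
    rw [Finset.sum_eq_single j (fun k _ hk => by rw [deg0_app_ne _ hk, comp_zero])
      (fun hi => (hi (by simp [h])).elim), deg0_app_self]
  · rw [Hom.app_eq_zero _ _ _ (by omega), f.app_eq_zero _ _ (by omega), zero_comp]

instance : Category (Gr A) where
  Hom := Hom
  id X := Hom.deg0 (fun i => 𝟙 (X.obj i))
  comp := Hom.comp
  id_comp f := by
    ext i j
    rw [Hom.deg0_comp_app, Category.id_comp]
  comp_id f := by
    ext i j
    rw [Hom.comp_deg0_app, Category.comp_id]
  assoc f g h := by
    ext i l
    rw [Hom.comp_app_of_le _ _ le_rfl le_rfl, Hom.comp_app_of_le _ _ le_rfl le_rfl]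
    trans ∑ k ∈ Finset.Icc i l, ∑ j ∈ Finset.Icc i l, f.app i j ≫ g.app j k ≫ h.app k l
    · refine Finset.sum_congr rfl (fun k hk => ?_)
      rw [Hom.comp_app_of_le f g le_rfl (Finset.mem_Icc.1 hk).2, Preadditive.sum_comp]
      simp
    · rw [Finset.sum_comm]
      refine Finset.sum_congr rfl (fun j hj => ?_)
      rw [Hom.comp_app_of_le g h (Finset.mem_Icc.1 hj).1 le_rfl, Preadditive.comp_sum]

@[ext]
lemma hom_ext {X Y : Gr A} {f g : X ⟶ Y} (h : ∀ i j, f.app i j = g.app i j) : f = g :=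
  Hom.ext (by funext i j; exact h i j)

lemma comp_app {X Y Z : Gr A} (f : X ⟶ Y) (g : Y ⟶ Z) (i j : ℤ) :
    (f ≫ g).app i j = ∑ k ∈ Finset.Icc i j, f.app i k ≫ g.app k j := rfl

lemma id_app_self (X : Gr A) (i : ℤ) : Hom.app (𝟙 X) i i = 𝟙 (X.obj i) :=
  Hom.deg0_app_self _ i

instance (X Y : Gr A) : Add (X ⟶ Y) :=
  ⟨fun f g => ⟨fun i j => f.app i j + g.app i j, fun i j h => by
    rw [f.app_eq_zero i j h, g.app_eq_zero i j h, add_zero]⟩⟩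

instance (X Y : Gr A) : Zero (X ⟶ Y) := ⟨⟨fun _ _ => 0, fun _ _ _ => rfl⟩⟩

instance (X Y : Gr A) : Neg (X ⟶ Y) :=
  ⟨fun f => ⟨fun i j => -f.app i j, fun i j h => by rw [f.app_eq_zero i j h, neg_zero]⟩⟩

@[simp] lemma add_app {X Y : Gr A} (f g : X ⟶ Y) (i j : ℤ) :
    (f + g).app i j = f.app i j + g.app i j := rfl

@[simp] lemma zero_app {X Y : Gr A} (i j : ℤ) : Hom.app (0 : X ⟶ Y) i j = 0 := rfl

@[simp] lemma neg_app {X Y : Gr A} (f : X ⟶ Y) (i j : ℤ) : (-f).app i j = -f.app i j := rfl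

instance : Preadditive (Gr A) where
  homGroup X Y :=
    { add_assoc := fun f g h => by ext; simp [add_assoc]
      zero_add := fun f => by ext; simp
      add_zero := fun f => by ext; simp
      nsmul := nsmulRec
      zsmul := zsmulRec
      neg_add_cancel := fun f => by ext; simp
      add_comm := fun f g => by ext; simp [add_comm] }
  add_comp X Y Z f f' g := by
    ext i j
    simp [comp_app, Finset.sum_add_distrib]
  comp_add X Y Z f g g' := by
    ext i j
    simp [comp_app, Finset.sum_add_distrib]

/-- `Hom.deg0` as a morphism of `gr A`. -/
def deg0 {X Y : Gr A} (φ : ∀ i, X.obj i ⟶ Y.obj i) : X ⟶ Y := Hom.deg0 φ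

@[simp] lemma deg0_comp {X Y Z : Gr A} (φ : ∀ i, X.obj i ⟶ Y.obj i) (ψ : ∀ i, Y.obj i ⟶ Z.obj i) :
    deg0 φ ≫ deg0 ψ = deg0 (fun i => φ i ≫ ψ i) := by
  ext i j
  refine (Hom.deg0_comp_app φ (deg0 ψ) i j).trans ?_
  by_cases h : i = j
  · subst h
    simp [deg0, Hom.deg0_app_self]
  · simp [deg0, Hom.deg0_app_ne _ h]

lemma deg0_id (X : Gr A) : deg0 (fun i => 𝟙 (X.obj i)) = 𝟙 X := rfl

lemma deg0_add {X Y : Gr A} (φ ψ : ∀ i, X.obj i ⟶ Y.obj i) :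
    deg0 φ + deg0 ψ = deg0 (fun i => φ i + ψ i) := by
  ext i j
  by_cases h : i = j
  · subst h
    simp [deg0, Hom.deg0_app_self]
  · simp [deg0, Hom.deg0_app_ne _ h]

lemma deg0_zero {X Y : Gr A} : deg0 (fun i => (0 : X.obj i ⟶ Y.obj i)) = 0 := by
  ext i j
  by_cases h : i = j
  · subst h
    simp [deg0, Hom.deg0_app_self]
  · simp [deg0, Hom.deg0_app_ne _ h]

instance [HasBinaryBiproducts A] : HasBinaryBiproducts (Gr A) where
  has_binary_biproduct X Y :=
    HasBinaryBiproduct.mk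
      { bicone :=
          { pt := ⟨fun i => X.obj i ⊞ Y.obj i⟩
            fst := deg0 (fun _ => biprod.fst)
            snd := deg0 (fun _ => biprod.snd)
            inl := deg0 (fun _ => biprod.inl)
            inr := deg0 (fun _ => biprod.inr)
            inl_fst := by simp [deg0_id]
            inl_snd := by simp [deg0_zero]
            inr_fst := by simp [deg0_zero]
            inr_snd := by simp [deg0_id] }
        isBilimit := isBinaryBilimitOfTotal _ (by simp [deg0_add, biprod.total, ← deg0_id]) }

/-- The functor `(1)`: `X(1)^j = X^(j+1)` and `f(1)_n^j = f_n^(j+1)`. -/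
@[simps]
def shift : Gr A ⥤ Gr A where
  obj X := ⟨fun i => X.obj (i + 1)⟩
  map f := ⟨fun i j => f.app (i + 1) (j + 1), fun i j h => f.app_eq_zero _ _ (by omega)⟩
  map_id X := by
    ext i j
    by_cases h : i = j
    · subst h
      exact (id_app_self X _).trans
        (id_app_self (⟨fun i => X.obj (i + 1)⟩ : Gr A) i).symm
    · exact (Hom.deg0_app_ne (fun i => 𝟙 (X.obj i)) (by omega)).trans
        (Hom.deg0_app_ne (X := ⟨fun i => X.obj (i + 1)⟩) (Y := ⟨fun i => X.obj (i + 1)⟩)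
          (fun i => 𝟙 (X.obj (i + 1))) h).symm
  map_comp f g := by
    ext i j
    change ∑ k ∈ Finset.Icc (i + 1) (j + 1), _ = ∑ k ∈ Finset.Icc i j, _
    rw [← Finset.image_add_right_Icc i j 1, Finset.sum_image (by simp)]

instance shift_additive : (shift : Gr A ⥤ Gr A).Additive where
  map_add {X Y f g} := by
    ext i j
    rfl

lemma eqToHom_app_eqToHom {X Y : Gr A} (g : X ⟶ Y) {i i' j j' : ℤ} (hi : i' = i) (hj : j' = j) :
    eqToHom (by rw [hi]) ≫ g.app i' j' ≫ eqToHom (by rw [hj]) = g.app i j := by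
  subst hi hj
  simp

instance shift_isEquivalence : (shift : Gr A ⥤ Gr A).IsEquivalence where
  faithful := ⟨fun {X Y f g} h => by
    ext i j
    have : f.app (i - 1 + 1) (j - 1 + 1) = g.app (i - 1 + 1) (j - 1 + 1) :=
      congr_arg (fun k => Hom.app k (i - 1) (j - 1)) h
    rw [← eqToHom_app_eqToHom f (sub_add_cancel i 1) (sub_add_cancel j 1),
      ← eqToHom_app_eqToHom g (sub_add_cancel i 1) (sub_add_cancel j 1), this]⟩
  full := ⟨fun {X Y} g => by
    have e : ∀ (Z : Gr A) (i : ℤ), (shift.obj Z).obj (i - 1) = Z.obj i := fun Z i => by simp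
    refine ⟨⟨fun i j => eqToHom (e X i).symm ≫ g.app (i - 1) (j - 1) ≫ eqToHom (e Y j),
      fun i j h => by rw [g.app_eq_zero _ _ (by omega), zero_comp, comp_zero]⟩, ?_⟩
    ext i j
    exact eqToHom_app_eqToHom g (add_sub_cancel_right i 1) (add_sub_cancel_right j 1)⟩
  essSurj := ⟨fun Y => by
    have e : ∀ i, (shift.obj (⟨fun i => Y.obj (i - 1)⟩ : Gr A)).obj i = Y.obj i :=
      fun i => by simp
    exact ⟨⟨fun i => Y.obj (i - 1)⟩, ⟨{
      hom := deg0 (fun i => eqToHom (e i))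
      inv := deg0 (fun i => eqToHom (e i).symm)
      hom_inv_id := by simp only [deg0_comp, eqToHom_trans, eqToHom_refl]; rfl
      inv_hom_id := by simp only [deg0_comp, eqToHom_trans, eqToHom_refl]; rfl }⟩⟩⟩

/-- The components of `η_X = {0, id, 0, 0, …} : X(1) ⟶ X`. -/
def etaComp (X : Gr A) (i j : ℤ) : X.obj (i + 1) ⟶ X.obj j :=
  if h : i + 1 = j then eqToHom (congrArg X.obj h) else 0

lemma etaComp_self (X : Gr A) (i : ℤ) : etaComp X i (i + 1) = 𝟙 _ := by
  simp [etaComp]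

lemma etaComp_ne (X : Gr A) {i j : ℤ} (h : i + 1 ≠ j) : etaComp X i j = 0 :=
  dif_neg h

/-- The natural transformation `η : (1) ⟶ Id`. -/
def eta : (shift : Gr A ⥤ Gr A) ⟶ 𝟭 (Gr A) where
  app X :=
    { app := etaComp X
      app_eq_zero := fun i j h => etaComp_ne X (by omega) }
  naturality X Y f := by
    ext i j
    change ∑ k ∈ Finset.Icc i j, f.app (i + 1) (k + 1) ≫ etaComp Y k j =
      ∑ k ∈ Finset.Icc i j, etaComp X i k ≫ f.app k j
    by_cases hij : i + 1 ≤ j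
    · obtain ⟨j, rfl⟩ : ∃ k, j = k + 1 := ⟨j - 1, by omega⟩
      rw [Finset.sum_eq_single j
          (fun k _ hk => by rw [etaComp_ne _ (by omega), comp_zero])
          (fun h => (h (Finset.mem_Icc.2 ⟨by omega, by omega⟩)).elim),
        Finset.sum_eq_single (i + 1)
          (fun k _ hk => by rw [etaComp_ne _ (by omega), zero_comp])
          (fun h => (h (Finset.mem_Icc.2 ⟨by omega, by omega⟩)).elim),
        etaComp_self, etaComp_self, Category.id_comp, Category.comp_id]
    · rw [Finset.sum_eq_zero, Finset.sum_eq_zero]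
      · intro k hk
        rw [Finset.mem_Icc] at hk
        rw [etaComp_ne _ (by omega), zero_comp]
      · intro k hk
        rw [Finset.mem_Icc] at hk
        rw [etaComp_ne _ (by omega), comp_zero]

lemma eta_app_shift (X : Gr A) : eta.app (shift.obj X) = shift.map (eta.app X) := by
  ext i j
  change etaComp (shift.obj X) i j = etaComp X (i + 1) (j + 1)
  by_cases h : i + 1 = j
  · subst h
    rw [etaComp_self, etaComp_self]
    rfl
  · rw [etaComp_ne _ h, etaComp_ne _ (by omega)]
    rfl

end Gr
end GradedCategory

section Stable

/-- An additive autoequivalence `(1)` of `B` and a natural transformation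
`η : (1) ⟶ Id` with `η_{X(1)} = η_X(1)`. -/
structure Twist (B : Type u) [Category.{v} B] [Preadditive B] where
  functor : B ⥤ B
  additive : functor.Additive
  isEquivalence : functor.IsEquivalence
  η : functor ⟶ 𝟭 B
  η_app_functor : ∀ X : B, η.app (functor.obj X) = functor.map (η.app X)

attribute [instance] Twist.additive

variable {B : Type u} [Category.{v} B] [Preadditive B] (τ : Twist B)

namespace Twist

/-- The functor `(1)` on complexes. -/
abbrev onCplx : CochainComplex B ℤ ⥤ CochainComplex B ℤ :=
  τ.functor.mapHomologicalComplex (ComplexShape.up ℤ)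

/-- The natural transformation `η` on complexes. -/
def ηCplx : τ.onCplx ⟶ 𝟭 (CochainComplex B ℤ) where
  app X :=
    { f := fun n => τ.η.app (X.X n)
      comm' := fun i j _ => (τ.η.naturality (X.d i j)).symm }
  naturality X Y f := by
    ext n
    exact τ.η.naturality (f.f n)

/-- Chain maps `f`, `g` are `η`-homotopic: there are `s^n : X^n(1) ⟶ Y^(n-1)` with
`(f^n - g^n) η = s^(n+1) d_X^n(1) + d_Y^(n-1) s^n`. -/
def EtaHomotopic {X Y : CochainComplex B ℤ} (f g : X ⟶ Y) : Prop :=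
  Nonempty (Homotopy (τ.ηCplx.app X ≫ f) (τ.ηCplx.app X ≫ g))

lemma exists_cochain {X Y : CochainComplex B ℤ} {f : X ⟶ Y} (H : Homotopy f 0) :
    ∃ z : CochainComplex.HomComplex.Cochain X Y (-1),
      CochainComplex.HomComplex.δ (-1) 0 z = CochainComplex.HomComplex.Cochain.ofHom f := by
  obtain ⟨z, hz⟩ := CochainComplex.HomComplex.Cochain.equivHomotopy _ _ H
  exact ⟨z, by simpa using hz.symm⟩

lemma η_app_of_total {P Q R : B} (a : P ⟶ Q) (b : Q ⟶ P) (c : P ⟶ R) (d : R ⟶ P)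
    (h : a ≫ b + c ≫ d = 𝟙 P) :
    τ.η.app P = τ.functor.map a ≫ τ.η.app Q ≫ b + τ.functor.map c ≫ τ.η.app R ≫ d := by
  have n1 := τ.η.naturality_assoc a b
  have n2 := τ.η.naturality_assoc c d
  dsimp at n1 n2
  rw [n1, n2, ← Preadditive.comp_add, h]
  exact (Category.comp_id _).symm

variable [HasBinaryBiproducts B]

/-- `X ⟶ Y ⟶ Z` is an `η`-conflation: it is isomorphic to the standard exact pair
`V ⟶ cone φ ⟶ U[1]` of a chain map `φ : U ⟶ V` which factors through `η_V`. -/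
def IsConflation {X Y Z : CochainComplex B ℤ} (i : X ⟶ Y) (p : Y ⟶ Z) : Prop :=
  ∃ (U V : CochainComplex B ℤ) (φ : U ⟶ V) (a : U ⟶ τ.onCplx.obj V)
    (e₁ : X ≅ V) (e₂ : Y ≅ mappingCone φ) (e₃ : Z ≅ (shiftFunctor _ (1 : ℤ)).obj U),
    φ = a ≫ τ.ηCplx.app V ∧
      i ≫ e₂.hom = e₁.hom ≫ mappingCone.inr φ ∧
      p ≫ e₃.hom = e₂.hom ≫ (mappingCone.triangle φ).mor₃

/-- `i` is an `η`-inflation. -/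
def IsInflation {X Y : CochainComplex B ℤ} (i : X ⟶ Y) : Prop :=
  ∃ (Z : CochainComplex B ℤ) (p : Y ⟶ Z), τ.IsConflation i p

/-- `I` is an injective object of the exact category `(C(B), E_η)`. -/
def IsInjective (I : CochainComplex B ℤ) : Prop :=
  ∀ ⦃X Y : CochainComplex B ℤ⦄ (i : X ⟶ Y), τ.IsInflation i →
    ∀ f : X ⟶ I, ∃ g : Y ⟶ I, i ≫ g = f

/-- The relation defining the stable category of `(C(B), E_η)`: the difference of the two
chain maps factors through an injective object. -/
def stableRel : HomRel (CochainComplex B ℤ) := fun X Y f g =>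
  ∃ (I : CochainComplex B ℤ) (a : X ⟶ I) (b : I ⟶ Y), τ.IsInjective I ∧ a ≫ b = f - g

section

open CochainComplex.HomComplex

lemma inflation_inr (X : CochainComplex B ℤ) :
    τ.IsInflation (mappingCone.inr (τ.ηCplx.app X)) :=
  ⟨_, (mappingCone.triangle (τ.ηCplx.app X)).mor₃, _, _, τ.ηCplx.app X, 𝟙 _, Iso.refl _,
    Iso.refl _, Iso.refl _, by simp, by simp,
    (Category.comp_id _).trans (Category.id_comp _).symm⟩

/-- `η` is null-homotopic on `cone(η_W)`. -/
lemma homotopy_cone (W : CochainComplex B ℤ) :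
    Nonempty (Homotopy (τ.ηCplx.app (mappingCone (τ.ηCplx.app W))) 0) := by
  let φ := τ.ηCplx.app W
  refine ⟨(Cochain.equivHomotopy _ _).symm
    ⟨((mappingCone.snd φ).map τ.functor).comp (mappingCone.inl φ) (zero_add (-1)), ?_⟩⟩
  rw [δ_comp _ _ (zero_add (-1)) 1 0 0 (by omega) (by omega) (by omega), δ_map,
    mappingCone.δ_inl, mappingCone.δ_snd]
  ext n
  have h1 := τ.η_app_of_total _ _ _ _ (mappingCone.id_X φ n (n + 1) rfl)
  have e1 : τ.η.app ((τ.onCplx.obj W).X (n + 1)) = τ.functor.map (φ.f (n + 1)) :=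
    τ.η_app_functor (W.X (n + 1))
  rw [e1] at h1
  rw [Cochain.ofHom_v]
  refine h1.trans ?_
  rw [Cochain.add_v, Cochain.add_v, Cochain.units_smul_v, Cochain.comp_zero_cochain_v,
    Cochain.comp_v _ _ _ n (n + 1) n rfl (by omega)]
  simp
  refine (add_comm _ _).trans (congrArg₂ (· + ·) ?_ (Category.assoc _ _ _).symm)
  exact (τ.η.naturality_assoc ((mappingCone.snd φ).v n n (add_zero n)) _).symm

lemma isInjective_cone (W : CochainComplex B ℤ) :
    τ.IsInjective (mappingCone (τ.ηCplx.app W)) := by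
  rintro X Y i ⟨Z, p, U, V, φ, a, e₁, e₂, e₃, hφ, hi, -⟩ f
  obtain ⟨H⟩ := τ.homotopy_cone W
  have hf : φ ≫ e₁.inv ≫ f = (a ≫ τ.onCplx.map (e₁.inv ≫ f)) ≫ τ.ηCplx.app _ := by
    rw [hφ, Category.assoc, Category.assoc]
    exact congrArg (a ≫ ·) (τ.ηCplx.naturality (e₁.inv ≫ f)).symm
  let H' : Homotopy (φ ≫ e₁.inv ≫ f) 0 :=
    (Homotopy.ofEq hf).trans ((H.compLeft _).trans (Homotopy.ofEq comp_zero))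
  obtain ⟨z, hz⟩ := exists_cochain H'
  refine ⟨e₂.hom ≫ mappingCone.desc φ z (e₁.inv ≫ f) ?_, ?_⟩
  · exact hz
  · rw [← Category.assoc, hi, Category.assoc, mappingCone.inr_desc, Iso.hom_inv_id_assoc]

/-- Two chain maps agree in the stable category iff they are `η`-homotopic. -/
lemma stableRel_iff {X Y : CochainComplex B ℤ} (f g : X ⟶ Y) :
    τ.stableRel f g ↔ τ.EtaHomotopic f g := by
  constructor
  · rintro ⟨I, a, b, hI, hab⟩
    obtain ⟨r, hr⟩ := hI _ (τ.inflation_inr I) (𝟙 I)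
    obtain ⟨H⟩ := τ.homotopy_cone I
    have hn : Nonempty (Homotopy (τ.ηCplx.app X ≫ (f - g)) 0) := by
      have h : τ.ηCplx.app X ≫ (f - g) =
          τ.onCplx.map (a ≫ mappingCone.inr _) ≫ τ.ηCplx.app _ ≫ r ≫ b := by
        rw [← hab, ← Category.assoc, τ.ηCplx.naturality_assoc]
        simp [reassoc_of% hr]
      exact ⟨(Homotopy.ofEq h).trans (((H.compRight _).compLeft _).trans
        (Homotopy.ofEq (by simp)))⟩
    obtain ⟨h⟩ := hn
    rw [Preadditive.comp_sub] at h
    exact ⟨(Homotopy.equivSubZero).symm h⟩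
  · rintro ⟨H⟩
    have H0 : Homotopy (τ.ηCplx.app X ≫ (f - g)) 0 := by
      rw [Preadditive.comp_sub]
      exact Homotopy.equivSubZero H
    obtain ⟨z, hz⟩ := exists_cochain H0
    refine ⟨_, mappingCone.inr (τ.ηCplx.app X), mappingCone.desc _ z (f - g) ?_,
      τ.isInjective_cone X, ?_⟩
    · exact hz
    · rw [mappingCone.inr_desc]

end

instance : Congruence τ.stableRel where
  comp_left := by
    rintro _ _ _ f g g' ⟨I, a, b, hI, h⟩
    exact ⟨I, f ≫ a, b, hI, by rw [Category.assoc, h, Preadditive.comp_sub]⟩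
  comp_right := by
    rintro _ _ _ f f' g ⟨I, a, b, hI, h⟩
    exact ⟨I, a, b ≫ g, hI, by rw [← Category.assoc, h, Preadditive.sub_comp]⟩
  equivalence := by
    refine ⟨fun f => ?_, fun h => ?_, fun h h' => ?_⟩
    · exact (τ.stableRel_iff _ _).2 ⟨Homotopy.refl _⟩
    · obtain ⟨h⟩ := (τ.stableRel_iff _ _).1 h
      exact (τ.stableRel_iff _ _).2 ⟨h.symm⟩
    · obtain ⟨h⟩ := (τ.stableRel_iff _ _).1 h
      obtain ⟨h'⟩ := (τ.stableRel_iff _ _).1 h'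
      exact (τ.stableRel_iff _ _).2 ⟨h.trans h'⟩

lemma stableRel_add ⦃X Y : CochainComplex B ℤ⦄ (f₁ f₂ g₁ g₂ : X ⟶ Y)
    (hf : τ.stableRel f₁ f₂) (hg : τ.stableRel g₁ g₂) :
    τ.stableRel (f₁ + g₁) (f₂ + g₂) := by
  obtain ⟨h⟩ := (τ.stableRel_iff _ _).1 hf
  obtain ⟨h'⟩ := (τ.stableRel_iff _ _).1 hg
  refine (τ.stableRel_iff _ _).2 ?_
  unfold EtaHomotopic
  rw [Preadditive.comp_add, Preadditive.comp_add]
  exact ⟨h.add h'⟩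

/-- The stable category `K_η(B)` of `(C(B), E_η)`. -/
def KEta : Type (max u v) := CategoryTheory.Quotient τ.stableRel

instance : Category τ.KEta := inferInstanceAs (Category (CategoryTheory.Quotient τ.stableRel))

instance : Preadditive τ.KEta :=
  CategoryTheory.Quotient.preadditive τ.stableRel τ.stableRel_add

/-- The quotient functor `C(B) ⥤ K_η(B)`. -/
def toKEta : CochainComplex B ℤ ⥤ τ.KEta := CategoryTheory.Quotient.functor τ.stableRel

lemma toKEta_map_eq_iff {X Y : CochainComplex B ℤ} (f g : X ⟶ Y) :
    τ.toKEta.map f = τ.toKEta.map g ↔ τ.EtaHomotopic f g :=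
  (CategoryTheory.Quotient.functor_map_eq_iff τ.stableRel f g).trans (τ.stableRel_iff f g)

/-- The translation functor `(1)[1]` on complexes. -/
abbrev translationCplx : CochainComplex B ℤ ⥤ CochainComplex B ℤ :=
  τ.onCplx ⋙ shiftFunctor (CochainComplex B ℤ) (1 : ℤ)

lemma stableRel_translation {X Y : CochainComplex B ℤ} (f g : X ⟶ Y) (h : τ.stableRel f g) :
    τ.stableRel (τ.translationCplx.map f) (τ.translationCplx.map g) := by
  obtain ⟨h⟩ := (τ.stableRel_iff _ _).1 h
  refine (τ.stableRel_iff _ _).2 ?_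
  let e := (τ.onCplx.commShiftIso (1 : ℤ)).app (τ.onCplx.obj X)
  have he : τ.ηCplx.app (τ.translationCplx.obj X) =
      e.hom ≫ τ.translationCplx.map (τ.ηCplx.app X) := by
    ext n
    refine (τ.η_app_functor (X.X (n + 1))).trans ?_
    exact (Category.id_comp _).symm
  have key : ∀ k : X ⟶ Y, τ.ηCplx.app (τ.translationCplx.obj X) ≫ τ.translationCplx.map k =
      e.hom ≫ τ.translationCplx.map (τ.ηCplx.app X ≫ k) := by
    intro k
    rw [he, Category.assoc, Functor.map_comp]
  unfold EtaHomotopic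
  rw [key, key]
  exact ⟨(Homotopy.shift (τ.functor.mapHomotopy h) 1).compLeft e.hom⟩

/-- The translation functor of `K_η(B)`, induced by `(1)[1]`. -/
def translation : τ.KEta ⥤ τ.KEta :=
  CategoryTheory.Quotient.lift τ.stableRel (τ.translationCplx ⋙ τ.toKEta)
    (fun _ _ f g h => CategoryTheory.Quotient.sound _ (τ.stableRel_translation f g h))

/-- The third map `cone(η_X ≫ f) ⟶ X(1)[1]` of the standard triangle of `f`. -/
def standardMor₃ {X Y : CochainComplex B ℤ} (f : X ⟶ Y) :
    τ.toKEta.obj (mappingCone (τ.ηCplx.app X ≫ f)) ⟶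
      τ.translation.obj (τ.toKEta.obj X) :=
  τ.toKEta.map (mappingCone.triangle (τ.ηCplx.app X ≫ f)).mor₃

/-- The triangles of `K_η(B)`: the sequences `X ⟶ Y ⟶ Z ⟶ X(1)[1]` isomorphic to a standard triangle
`X ⟶ Y ⟶ cone(η_X ≫ f) ⟶ X(1)[1]` of a chain map `f : X ⟶ Y`. The sign of the third map is
the one of the distinguished triangles of `HomotopyCategory`. -/
def IsTriangle {X Y Z : τ.KEta} (u : X ⟶ Y) (v : Y ⟶ Z) (w : Z ⟶ τ.translation.obj X) : Prop :=
  ∃ (P Q : CochainComplex B ℤ) (f : P ⟶ Q) (a : X ≅ τ.toKEta.obj P) (b : Y ≅ τ.toKEta.obj Q)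
    (c : Z ≅ τ.toKEta.obj (mappingCone (τ.ηCplx.app P ≫ f))),
    u ≫ b.hom = a.hom ≫ τ.toKEta.map f ∧
      v ≫ c.hom = b.hom ≫ τ.toKEta.map (mappingCone.inr (τ.ηCplx.app P ≫ f)) ∧
      w ≫ τ.translation.map a.hom = c.hom ≫ τ.standardMor₃ f

end Twist
end Stable

section Modules

variable (Λ : Type u) [Ring Λ]

/-- The projective `Λ`-modules, as a class of objects of the category of modules. -/
def isProjectiveModule : ObjectProperty (ModuleCat.{u} Λ) := fun M => Module.Projective Λ M

/-- The category `Proj Λ` of projective `Λ`-modules. -/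
abbrev ProjMod : Type (u + 1) := (isProjectiveModule Λ).FullSubcategory

instance : (isProjectiveModule Λ).IsClosedUnderIsomorphisms where
  of_iso e h := by
    have : Module.Projective Λ _ := h
    exact Module.Projective.of_equiv e.toLinearEquiv

instance : (isProjectiveModule Λ).ContainsZero where
  exists_zero := ⟨ModuleCat.of Λ PUnit.{u + 1}, ModuleCat.isZero_of_subsingleton _,
    (inferInstance : Module.Projective Λ PUnit.{u + 1})⟩

lemma isProjectiveModule_biprod (M N : ModuleCat.{u} Λ) (hM : isProjectiveModule Λ M)
    (hN : isProjectiveModule Λ N) : isProjectiveModule Λ (M ⊞ N) := by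
  have : Module.Projective Λ M := hM
  have : Module.Projective Λ N := hN
  exact (isProjectiveModule Λ).prop_of_iso (ModuleCat.biprodIsoProd M N).symm
    (inferInstance : Module.Projective Λ (M × N))

/-- A full subcategory closed under binary biproducts has binary biproducts. -/
lemma hasBinaryBiproducts_fullSubcategory {C : Type w} [Category.{v} C] [Preadditive C]
    [HasBinaryBiproducts C] (P : ObjectProperty C) (hP : ∀ X Y, P X → P Y → P (X ⊞ Y)) :
    HasBinaryBiproducts P.FullSubcategory where
  has_binary_biproduct X Y := HasBinaryBiproduct.mk
    { bicone :=
        { pt := ⟨X.obj ⊞ Y.obj, hP _ _ X.property Y.property⟩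
          fst := ObjectProperty.homMk biprod.fst
          snd := ObjectProperty.homMk biprod.snd
          inl := ObjectProperty.homMk biprod.inl
          inr := ObjectProperty.homMk biprod.inr
          inl_fst := by ext1; exact biprod.inl_fst
          inl_snd := by ext1; exact biprod.inl_snd
          inr_fst := by ext1; exact biprod.inr_fst
          inr_snd := by ext1; exact biprod.inr_snd }
      isBilimit := isBinaryBilimitOfTotal _ (by ext1; exact biprod.total) }

instance : HasBinaryBiproducts (ProjMod Λ) :=
  hasBinaryBiproducts_fullSubcategory _ (isProjectiveModule_biprod Λ)

/-- The homotopy category `K(Proj Λ)` of unbounded complexes. -/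
abbrev KProj : Type (u + 1) := HomotopyCategory (ProjMod Λ) (ComplexShape.up ℤ)

/-- The quotient functor `C(Proj Λ) ⥤ K(Proj Λ)`. -/
abbrev toKProj : CochainComplex (ProjMod Λ) ℤ ⥤ KProj Λ := HomotopyCategory.quotient _ _

variable {Λ}

/-- `T` is an object of `K^b(proj Λ)`: a bounded complex of finitely generated projective
modules. -/
def IsBoundedFG (T : CochainComplex (ProjMod Λ) ℤ) : Prop :=
  (∃ a b : ℤ, ∀ n, n < a ∨ b < n → IsZero (T.X n)) ∧ ∀ n, Module.Finite Λ (T.X n).obj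

/-- `X` is in `add T`: a direct summand of a finite direct sum of copies of `T`. -/
def IsAdd (T X : KProj Λ) : Prop :=
  ∃ (n : ℕ) (Y : KProj Λ), Nonempty (X ⊞ Y ≅ ⨁ fun _ : Fin n => T)

/-- `T` is a tilting complex over `Λ`. -/
structure IsTiltingComplex (T : CochainComplex (ProjMod Λ) ℤ) : Prop where
  isBoundedFG : IsBoundedFG T
  hom_shift_eq_zero : ∀ n : ℤ, n ≠ 0 →
    ∀ f : (toKProj Λ).obj T ⟶ (shiftFunctor (KProj Λ) n).obj ((toKProj Λ).obj T), f = 0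
  generates : ∀ P : ObjectProperty (KProj Λ), P.IsTriangulated → P.IsClosedUnderIsomorphisms →
    (∀ X, IsAdd ((toKProj Λ).obj T) X → P X) →
    ∀ X : CochainComplex (ProjMod Λ) ℤ, IsBoundedFG X → P ((toKProj Λ).obj X)

/-- The objects of `Sum T`: the direct sums in `K(Proj Λ)` of copies of `T`. -/
def isSum (T : CochainComplex (ProjMod Λ) ℤ) : ObjectProperty (KProj Λ) := fun X =>
  ∃ (ι : Type u) (i : ι → ((toKProj Λ).obj T ⟶ X)), Nonempty (IsColimit (Cofan.mk X i))

/-- The full subcategory `Sum T` of `K(Proj Λ)`. -/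
abbrev SumCat (T : CochainComplex (ProjMod Λ) ℤ) : Type (u + 1) := (isSum T).FullSubcategory

variable (T : CochainComplex (ProjMod Λ) ℤ)

instance : (isSum T).ContainsZero where
  exists_zero := ⟨0, isZero_zero _, PEmpty, fun x => x.elim,
    ⟨Cofan.IsColimit.mk _ (fun _ => 0) (fun _ j => j.elim)
      (fun _ _ _ => (isZero_zero _).eq_of_src _ _)⟩⟩

lemma isSum_biprod (X Y : KProj Λ) (hX : isSum T X) (hY : isSum T Y) : isSum T (X ⊞ Y) := by
  obtain ⟨ι, i, ⟨hi⟩⟩ := hX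
  obtain ⟨κ, k, ⟨hk⟩⟩ := hY
  refine ⟨ι ⊕ κ, Sum.elim (fun a => i a ≫ biprod.inl) (fun b => k b ≫ biprod.inr),
    ⟨Cofan.IsColimit.mk _
      (fun s => biprod.desc (Cofan.IsColimit.desc hi (fun a => s.inj (Sum.inl a)))
        (Cofan.IsColimit.desc hk (fun b => s.inj (Sum.inr b)))) ?_ ?_⟩⟩
  · rintro s (a | b)
    · simpa using Cofan.IsColimit.fac hi _ a
    · simpa using Cofan.IsColimit.fac hk _ b
  · intro s m hm
    apply biprod.hom_ext'
    · rw [biprod.inl_desc]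
      refine Cofan.IsColimit.hom_ext hi _ _ (fun a => ?_)
      rw [Cofan.IsColimit.fac hi]
      simpa using hm (Sum.inl a)
    · rw [biprod.inr_desc]
      refine Cofan.IsColimit.hom_ext hk _ _ (fun b => ?_)
      rw [Cofan.IsColimit.fac hk]
      simpa using hm (Sum.inr b)

instance : HasBinaryBiproducts (SumCat T) :=
  hasBinaryBiproducts_fullSubcategory _ (isSum_biprod T)

/-- The homotopy category `K(Sum T)`. -/
abbrev KSum : Type (u + 1) := HomotopyCategory (SumCat T) (ComplexShape.up ℤ)

/-- The quotient functor `C(Sum T) ⥤ K(Sum T)`. -/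
abbrev toKSum : CochainComplex (SumCat T) ℤ ⥤ KSum T := HomotopyCategory.quotient _ _

end Modules

section Theta

variable (Λ : Type u) [Ring Λ]

/-- The category `gr Proj Λ` with `(1)` and `η`. -/
def grTwist : Twist (Gr (ProjMod Λ)) where
  functor := Gr.shift
  additive := Gr.shift_additive
  isEquivalence := Gr.shift_isEquivalence
  η := Gr.eta
  η_app_functor := Gr.eta_app_shift

variable {Λ} {T : CochainComplex (ProjMod Λ) ℤ}

/-- For `X` in `C(Sum T)` and `j : ℤ`, the complex `(X^{•,j}, δ_0^{•,j})` of projective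
modules underlying the object of `Sum T` in degree `j`. -/
def row (X : CochainComplex (SumCat T) ℤ) (j : ℤ) : CochainComplex (ProjMod Λ) ℤ :=
  (X.X j).obj.as

/-- A chain map `a : X^{•,j} ⟶ Y^{•,k}` represents a morphism of `Sum T` if its homotopy class
is that morphism. -/
def Represents {X Y : CochainComplex (SumCat T) ℤ} {j k : ℤ} (a : row X j ⟶ row Y k)
    (φ : X.X j ⟶ Y.X k) : Prop :=
  (toKProj Λ).map a = φ.hom

/-- The bigraded object `Θ(X)^{ij} = X^{i-j,j}`. -/
def thetaObj (X : CochainComplex (SumCat T) ℤ) (i : ℤ) : Gr (ProjMod Λ) :=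
  ⟨fun j => (row X j).X (i - j)⟩

/-- The morphisms `(-1)^i δ_1^{i-j,j} : Θ(X)^{ij} = X^{i-j,j} ⟶ Θ(X)^{i+1,j+1} = X^{i-j,j+1}`. -/
def thetaD₁ {X : CochainComplex (SumCat T) ℤ} (δ₁ : ∀ j : ℤ, row X j ⟶ row X (j + 1))
    (i j : ℤ) : (thetaObj X i).obj j ⟶ (thetaObj X (i + 1)).obj (j + 1) :=
  i.negOnePow • ((δ₁ j).f (i - j) ≫
    ((row X (j + 1)).XIsoOfEq (show i - j = i + 1 - (j + 1) by omega)).hom)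

/-- A value of `Θ` at `X`: a complex over `gr Proj Λ` with components `X^{i-j,j}` whose
differential satisfies `d_0^{ij} = δ_0^{i-j,j}` and `d_1^{ij} = (-1)^i δ_1^{i-j,j}`, where
the chain maps `δ_1^{•,j}` represent the differential of `X`. -/
structure ThetaLift (X : CochainComplex (SumCat T) ℤ) where
  d : ∀ i k : ℤ, thetaObj X i ⟶ thetaObj X k
  shape : ∀ i k : ℤ, i + 1 ≠ k → d i k = 0
  d_comp_d : ∀ i : ℤ, d i (i + 1) ≫ d (i + 1) (i + 1 + 1) = 0
  d_zero : ∀ i j : ℤ, (d i (i + 1)).app j j = (row X j).d (i - j) (i + 1 - j)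
  d_one : ∃ δ₁ : ∀ j : ℤ, row X j ⟶ row X (j + 1),
    (∀ j, Represents (δ₁ j) (X.d j (j + 1))) ∧
    ∀ i j : ℤ, (d i (i + 1)).app j (j + 1) = thetaD₁ δ₁ i j

/-- The underlying complex over `gr Proj Λ`. -/
def ThetaLift.cplx {X : CochainComplex (SumCat T) ℤ} (L : ThetaLift X) :
    CochainComplex (Gr (ProjMod Λ)) ℤ where
  X := thetaObj X
  d := L.d
  shape i k h := L.shape i k h
  d_comp_d' i k l hik hkl := by
    obtain rfl : i + 1 = k := hik
    obtain rfl : i + 1 + 1 = l := hkl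
    exact L.d_comp_d i

/-- A value of `Θ` at `α`: a chain map `f = {f_0, f_1, …} : Θ(X) ⟶ Θ(Y)` with
`f_0^{ij} = α^{i-j,j}`, where the chain maps `α^{•,j}` represent the components of `α`. -/
def IsThetaLift {X Y : CochainComplex (SumCat T) ℤ} (LX : ThetaLift X) (LY : ThetaLift Y)
    (α : X ⟶ Y) (f : LX.cplx ⟶ LY.cplx) : Prop :=
  ∃ a : ∀ j : ℤ, row X j ⟶ row Y j, (∀ j, Represents (a j) (α.f j)) ∧
    ∀ i j : ℤ, (f.f i).app j j = (a j).f (i - j)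

variable (T)

/-- Rickard's lifting operation `Θ : C(Sum T) → C(gr Proj Λ)`: a choice of lifts of all objects
and of all morphisms. -/
structure Theta where
  obj : ∀ X : CochainComplex (SumCat T) ℤ, ThetaLift X
  map : ∀ {X Y : CochainComplex (SumCat T) ℤ}, (X ⟶ Y) → ((obj X).cplx ⟶ (obj Y).cplx)
  isThetaLift_map : ∀ {X Y : CochainComplex (SumCat T) ℤ} (α : X ⟶ Y),
    IsThetaLift (obj X) (obj Y) α (map α)

variable {T}

/-- `Θ` induces a functor `K(Sum T) ⥤ K_η(gr Proj Λ)`: up to `η`-homotopy, it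
sends homotopic chain maps to the same chain map and preserves identities and composition. -/
structure Theta.InducesFunctor (Θ : Theta T) : Prop where
  map_homotopic : ∀ {X Y : CochainComplex (SumCat T) ℤ} (α β : X ⟶ Y), Homotopy α β →
    (grTwist Λ).EtaHomotopic (Θ.map α) (Θ.map β)
  map_id : ∀ X : CochainComplex (SumCat T) ℤ,
    (grTwist Λ).EtaHomotopic (Θ.map (𝟙 X)) (𝟙 (Θ.obj X).cplx)
  map_comp : ∀ {X Y Z : CochainComplex (SumCat T) ℤ} (α : X ⟶ Y) (β : Y ⟶ Z),
    (grTwist Λ).EtaHomotopic (Θ.map (α ≫ β)) (Θ.map α ≫ Θ.map β)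

/-- The induced functor: `X ↦ Θ(X)` on objects, and the class of `α` goes to the class of
`Θ(α)`. -/
def Theta.functor (Θ : Theta T) (h : Θ.InducesFunctor) : KSum T ⥤ (grTwist Λ).KEta :=
  CategoryTheory.Quotient.lift (homotopic (SumCat T) (ComplexShape.up ℤ))
    { obj := fun X => (grTwist Λ).toKEta.obj (Θ.obj X).cplx
      map := fun α => (grTwist Λ).toKEta.map (Θ.map α)
      map_id := fun X => ((grTwist Λ).toKEta_map_eq_iff _ _).2 (h.map_id X)
      map_comp := fun α β => (((grTwist Λ).toKEta_map_eq_iff _ _).2 (h.map_comp α β)).trans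
        ((grTwist Λ).toKEta.map_comp _ _) }
    (fun _ _ α β hαβ => ((grTwist Λ).toKEta_map_eq_iff _ _).2
      (h.map_homotopic α β hαβ.some))

/-- `(F, ξ)` is a triangle functor from `K(Sum T)` to a stable category `K_η(B)`: `F` is
additive, `ξ : F ∘ [1] ≅ (1)[1] ∘ F`, and `F` sends triangles to triangles. -/
structure IsTriangleFunctor {B : Type w} [Category.{v} B] [Preadditive B] [HasBinaryBiproducts B]
    (τ : Twist B) (F : KSum T ⥤ τ.KEta)
    (ξ : shiftFunctor (KSum T) (1 : ℤ) ⋙ F ≅ F ⋙ τ.translation) : Prop where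
  additive : F.Additive
  map_triangle : ∀ t ∈ Pretriangulated.distinguishedTriangles (C := KSum T),
    τ.IsTriangle (F.map t.mor₁) (F.map t.mor₂) (F.map t.mor₃ ≫ ξ.hom.app t.obj₁)

end Theta

end
end RickardTheta

open RickardTheta

/-!
The `j`-th row of a complex `U` over `gr Proj Λ` is the complex formed by the `U^{ij}`, `i ∈ ℤ`,
with the differential `d_0`. The component of order `k - j` of a cochain of degree `n` over
`gr Proj Λ`, from the row `j` to the row `k`, is a cochain of degree `n - (k - j)` between complexes
of projective modules. With a suitable sign (`rowCochain`) the leading component of a coboundary is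
the coboundary of the leading component, and every family of leading components occurs
(`exists_rowCochain_eq`). If the rows are sums of copies of `T`, then a cocycle of nonzero degree
between rows is a coboundary (`isAcyclicHom_of_isSum`): such a sum is a retract of an actual direct
sum of complexes, and, `T` being bounded and finitely generated, a map from `T` to the latter is a
finite sum of maps to shifts of `T`. Hence the only obstructions to constructing something order by
order are in row degree zero, and these are the equations in `K(Proj Λ)` which hold for objects and
morphisms of `C(Sum T)`. Successive approximations converge (`exists_limit`), as each component of a
morphism of graded objects is determined in finitely many steps.

Applied to the Maurer-Cartan equation `δE + E² = 0` for a perturbation `E` of `d_0`, this gives the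
lifts of objects (`exists_curvature_eq_zero`, `exists_thetaLift`); applied to cocycles of degree zero,
the lifts of morphisms (`exists_rowMap_eq`), and two lifts of the same morphism are homotopic
(`nonempty_homotopy_of_rows`).

The remaining statements are formal once lifts are replaced by the more flexible realizations
(`Realization`): complexes over `gr Proj Λ` whose rows are isomorphic in `K(Proj Λ)` to the components
of an object of `C(Sum T)`, compatibly with the differentials. If `U` realizes `X`, then `U(1)[1]`
realizes `X[1]`, and if `f` lifts `α`, then `cone(f η)` realizes `cone(α)` (`IsLift.cone`): as `f η` has
no component of order zero, the rows of the cone are direct sums, and the component of order one of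
the differential of the cone contains `f_0`. A null-homotopic morphism factors through the cone of
an identity, which is realized by `cone(η)`, where `η` is null-homotopic. Therefore lifts of homotopic
morphisms are `η`-homotopic (`IsLift.etaHomotopic`), and two realizations of the same object are
canonically isomorphic in `K_η` (`realizationIso`). The isomorphisms `Θ(X[1]) ≅ Θ(X)(1)[1]` and
`Θ(cone(α)) ≅ cone(Θ(α) η)` are instances of the latter, and all their compatibilities express the
uniqueness of lifts.
-/

namespace RickardTheta

noncomputable section

open CochainComplex CochainComplex.HomComplex

/-! ### Components of morphisms of graded objects and of cochains -/

section Rows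

variable {A : Type u} [Category.{v} A] [Preadditive A]

namespace Gr

/-- The leading component of a composition of morphisms with components of orders at least `m₁` and
`m₂`. -/
lemma comp_app_eq_single {X Y Z : Gr A} (f : X ⟶ Y) (g : Y ⟶ Z) (i k j : ℤ) {m₁ m₂ : ℤ}
    (hf : ∀ j', j' < i + m₁ → f.app i j' = 0) (hg : ∀ j', j < j' + m₂ → g.app j' j = 0)
    (hk : k = i + m₁) (hj : j = k + m₂) :
    (f ≫ g).app i j = f.app i k ≫ g.app k j := by
  rw [comp_app]
  refine Finset.sum_eq_single k (fun b _ hbk => ?_) (fun h => ?_)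
  · rcases lt_or_gt_of_ne hbk with h | h
    · rw [hf b (by omega), zero_comp]
    · rw [hg b (by omega), comp_zero]
  · rw [Finset.mem_Icc, not_and_or, not_le, not_le] at h
    rcases h with h | h
    · rw [f.app_eq_zero i k h, zero_comp]
    · rw [g.app_eq_zero k j h, comp_zero]

lemma comp_app_self {X Y Z : Gr A} (f : X ⟶ Y) (g : Y ⟶ Z) (i : ℤ) :
    (f ≫ g).app i i = f.app i i ≫ g.app i i :=
  comp_app_eq_single f g i i i (m₁ := 0) (m₂ := 0) (fun _ h => f.app_eq_zero _ _ (by omega))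
    (fun _ h => g.app_eq_zero _ _ (by omega)) (by omega) (by omega)

lemma comp_app_succ {X Y Z : Gr A} (f : X ⟶ Y) (g : Y ⟶ Z) (i j : ℤ) (h : i + 1 = j) :
    (f ≫ g).app i j = f.app i i ≫ g.app i j + f.app i j ≫ g.app j j := by
  subst h
  rw [comp_app, show Finset.Icc i (i + 1) = {i, i + 1} by ext; simp; omega,
    Finset.sum_pair (by omega)]

@[simp] lemma sub_app {X Y : Gr A} (f g : X ⟶ Y) (i j : ℤ) :
    (f - g).app i j = f.app i j - g.app i j := by
  rw [sub_eq_add_neg, add_app, neg_app, sub_eq_add_neg]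

@[simp] lemma units_smul_app {X Y : Gr A} (a : ℤˣ) (f : X ⟶ Y) (i j : ℤ) :
    (a • f).app i j = a • f.app i j := by
  rcases Int.units_eq_one_or a with rfl | rfl
  · simp
  · simp

end Gr

/-- The `j`-th row of a complex over `gr A`, with the differential `d_0` and indexed so that its
term of degree `p` is `U^{p+j,j}`. -/
abbrev grRow (U : CochainComplex (Gr A) ℤ) (j : ℤ) : CochainComplex A ℤ where
  X p := (U.X (p + j)).obj j
  d p q := (U.d (p + j) (q + j)).app j j
  shape p q h := by
    rw [U.shape _ _ (fun h' => h (by rw [ComplexShape.up_Rel] at h' ⊢; omega)), Gr.zero_app]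
  d_comp_d' p q r _ _ := by
    rw [← Gr.comp_app_self, U.d_comp_d, Gr.zero_app]

variable {U V W : CochainComplex (Gr A) ℤ}

/-- The component of a cochain over `gr A` from the row `j` to the row `k`, as a cochain of degree
`r = n - (k - j)`. With the sign `(-1)^{i(k-j)}` at `U^{ij}`, the leading component of a coboundary
is the coboundary of the leading component. -/
def rowCochain {n : ℤ} (z : Cochain U V n) (j k r : ℤ) (h : r + k = n + j) :
    Cochain (grRow U j) (grRow V k) r :=
  Cochain.mk fun p q hpq =>
    ((p + j) * (k - j)).negOnePow • (z.v (p + j) (q + k) (by omega)).app j k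

lemma rowCochain_v {n : ℤ} (z : Cochain U V n) (j k r : ℤ) (h : r + k = n + j) (p q : ℤ)
    (hpq : p + r = q) :
    (rowCochain z j k r h).v p q hpq =
      ((p + j) * (k - j)).negOnePow • (z.v (p + j) (q + k) (by omega)).app j k := rfl

@[simp]
lemma rowCochain_add {n : ℤ} (z z' : Cochain U V n) (j k r : ℤ) (h : r + k = n + j) :
    rowCochain (z + z') j k r h = rowCochain z j k r h + rowCochain z' j k r h := by
  ext p q hpq
  simp only [rowCochain_v, Cochain.add_v, Gr.add_app, smul_add]

@[simp]
lemma rowCochain_neg {n : ℤ} (z : Cochain U V n) (j k r : ℤ) (h : r + k = n + j) :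
    rowCochain (-z) j k r h = -rowCochain z j k r h := by
  ext p q hpq
  simp only [rowCochain_v, Cochain.neg_v, Gr.neg_app, smul_neg]

@[simp]
lemma rowCochain_sub {n : ℤ} (z z' : Cochain U V n) (j k r : ℤ) (h : r + k = n + j) :
    rowCochain (z - z') j k r h = rowCochain z j k r h - rowCochain z' j k r h := by
  rw [sub_eq_add_neg, rowCochain_add, rowCochain_neg, sub_eq_add_neg]

@[simp]
lemma rowCochain_zero {n : ℤ} (j k r : ℤ) (h : r + k = n + j) :
    rowCochain (0 : Cochain U V n) j k r h = 0 := by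
  ext p q hpq
  simp only [rowCochain_v, Cochain.zero_v, Gr.zero_app, smul_zero]

/-- A cochain over `gr A` lies in the `m`-th step of the filtration by order: its components of
order less than `m` vanish. -/
def FiltGE (m : ℤ) {n : ℤ} (z : Cochain U V n) : Prop :=
  ∀ (p q : ℤ) (hpq : p + n = q) (j k : ℤ), k < j + m → (z.v p q hpq).app j k = 0

namespace FiltGE

variable {n m : ℤ}

lemma zero_order (z : Cochain U V n) : FiltGE 0 z :=
  fun p q hpq j k h => (z.v p q hpq).app_eq_zero j k (by omega)

lemma zero (m : ℤ) : FiltGE m (0 : Cochain U V n) := fun _ _ _ _ _ _ => rfl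

lemma mono {m m' : ℤ} {z : Cochain U V n} (h : FiltGE m z) (hm : m' ≤ m) : FiltGE m' z :=
  fun p q hpq j k hk => h p q hpq j k (by omega)

lemma add {z z' : Cochain U V n} (h : FiltGE m z) (h' : FiltGE m z') : FiltGE m (z + z') :=
  fun p q hpq j k hk => by
    rw [Cochain.add_v, Gr.add_app, h p q hpq j k hk, h' p q hpq j k hk, add_zero]

lemma neg {z : Cochain U V n} (h : FiltGE m z) : FiltGE m (-z) :=
  fun p q hpq j k hk => by
    rw [Cochain.neg_v, Gr.neg_app, h p q hpq j k hk, neg_zero]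

lemma sub {z z' : Cochain U V n} (h : FiltGE m z) (h' : FiltGE m z') : FiltGE m (z - z') := by
  rw [sub_eq_add_neg]
  exact h.add h'.neg

lemma comp {n₁ n₂ n₁₂ m₁ m₂ m₁₂ : ℤ} {z₁ : Cochain U V n₁} {z₂ : Cochain V W n₂}
    (h₁ : FiltGE m₁ z₁) (h₂ : FiltGE m₂ z₂) (h : n₁ + n₂ = n₁₂) (hm : m₁₂ = m₁ + m₂) :
    FiltGE m₁₂ (z₁.comp z₂ h) := fun p q hpq j k hk => by
  rw [Cochain.comp_v _ _ _ p _ q rfl (by omega), Gr.comp_app]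
  refine Finset.sum_eq_zero (fun l _ => ?_)
  rcases lt_or_ge l (j + m₁) with hl | hl
  · rw [h₁ _ _ _ _ _ hl, zero_comp]
  · rw [h₂ _ _ _ _ _ (by omega), comp_zero]

lemma δ {z : Cochain U V n} (hz : FiltGE m z) (n' : ℤ) : FiltGE m (δ n n' z) := by
  by_cases h : n + 1 = n'
  · intro p q hpq j k hk
    rw [δ_v n n' h z p q hpq _ _ rfl rfl, Gr.add_app, Gr.units_smul_app, Gr.comp_app, Gr.comp_app,
      Finset.sum_eq_zero, Finset.sum_eq_zero, smul_zero, add_zero]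
    · intro l hl
      rw [Finset.mem_Icc] at hl
      rw [hz _ _ _ _ _ (by omega), comp_zero]
    · intro l hl
      rw [Finset.mem_Icc] at hl
      rw [hz _ _ _ _ _ (by omega), zero_comp]
  · rw [δ_shape n n' h]
    exact zero m

/-- A cochain of order at least `m` has order at least `m + 1` if its leading components vanish. -/
lemma succ {z : Cochain U V n} (hz : FiltGE m z) {r : ℤ} (hr : r + m = n)
    (h : ∀ j k (hk : k = j + m), rowCochain z j k r (by omega) = 0) : FiltGE (m + 1) z := by
  intro p q hpq j k hk
  rcases lt_or_ge k (j + m) with hk' | hk'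
  · exact hz p q hpq j k hk'
  · obtain rfl : k = j + m := by omega
    obtain ⟨p, rfl⟩ : ∃ p', p = p' + j := ⟨p - j, by omega⟩
    obtain ⟨q, rfl⟩ : ∃ q', q = q' + (j + m) := ⟨q - (j + m), by omega⟩
    have := Cochain.congr_v (h j _ rfl) p q (by omega)
    rw [rowCochain_v, Cochain.zero_v, smul_eq_zero_iff_eq] at this
    exact this

lemma rowCochain_eq_zero {z : Cochain U V n} (hz : FiltGE m z) (j k r : ℤ) (h : r + k = n + j)
    (hk : k < j + m) : rowCochain z j k r h = 0 := by
  ext p q hpq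
  rw [rowCochain_v, hz _ _ _ _ _ hk, smul_zero, Cochain.zero_v]

end FiltGE

/-- A cochain of order at least `m` for every `m` vanishes. -/
lemma eq_zero_of_filtGE {n : ℤ} {z : Cochain U V n} (h : ∀ m : ℕ, FiltGE (m : ℤ) z) : z = 0 := by
  ext p q hpq j k
  rw [h (k - j + 1).toNat p q hpq j k (by omega)]
  rfl

/-- The leading component of a composition. -/
lemma rowCochain_comp {n₁ n₂ n₁₂ m₁ m₂ : ℤ} {z₁ : Cochain U V n₁} {z₂ : Cochain V W n₂}
    (h₁ : FiltGE m₁ z₁) (h₂ : FiltGE m₂ z₂) (h : n₁ + n₂ = n₁₂) (j k l r₁ r₂ r : ℤ)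
    (hk : k = j + m₁) (hl : l = k + m₂) (hr₁ : r₁ + k = n₁ + j) (hr₂ : r₂ + l = n₂ + k)
    (hr : r₁ + r₂ = r) :
    rowCochain (z₁.comp z₂ h) j l r (by omega) =
      (n₁ * m₂).negOnePow • (rowCochain z₁ j k r₁ hr₁).comp (rowCochain z₂ k l r₂ hr₂) hr := by
  ext p q hpq
  rw [Cochain.units_smul_v, Cochain.comp_v _ _ hr p _ q rfl (by omega), rowCochain_v, rowCochain_v,
    rowCochain_v, Cochain.comp_v _ _ h (p + j) (p + r₁ + k) (q + l) (by omega) (by omega),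
    Gr.comp_app_eq_single _ _ j k l (fun j' h' => h₁ _ _ _ _ _ h')
      (fun j' h' => h₂ _ _ _ _ _ h') hk hl, Linear.units_smul_comp, Linear.comp_units_smul,
    smul_smul, smul_smul, ← Int.negOnePow_add, ← Int.negOnePow_add]
  congr 1
  apply (Int.negOnePow_eq_iff _ _).2
  obtain rfl : r₁ = n₁ - m₁ := by omega
  subst hl hk
  have e : (p + j) * (j + m₁ + m₂ - j) - (n₁ * m₂ + (p + j) * (j + m₁ - j) +
      (p + (n₁ - m₁) + (j + m₁)) * (j + m₁ + m₂ - (j + m₁))) = 2 * (-(n₁ * m₂)) := by ring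
  rw [e]
  exact even_two_mul _

/-- A component of a coboundary to which only the parts of order zero of the differentials
contribute. -/
lemma rowCochain_δ_of_comp_app {n : ℤ} (z : Cochain U V n) (n' : ℤ) (hn : n + 1 = n')
    (j k r r' : ℤ) (hr : r + k = n + j) (hr' : r + 1 = r')
    (h₁ : ∀ (p q s : ℤ) (hpq : p + n = q),
      (z.v p q hpq ≫ V.d q s).app j k = (z.v p q hpq).app j k ≫ (V.d q s).app k k)
    (h₂ : ∀ (p q s : ℤ) (hqs : q + n = s),
      (U.d p q ≫ z.v q s hqs).app j k = (U.d p q).app j j ≫ (z.v q s hqs).app j k) :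
    rowCochain (δ n n' z) j k r' (by omega) = δ r r' (rowCochain z j k r hr) := by
  subst hn hr'
  ext p q hpq
  rw [rowCochain_v, δ_v n _ rfl z (p + j) (q + k) (by omega) (q - 1 + k) (p + 1 + j)
      (by omega) (by omega), δ_v r _ rfl _ p q hpq _ _ rfl rfl, rowCochain_v, rowCochain_v,
    Gr.add_app, Gr.units_smul_app, h₁, h₂, smul_add, Linear.units_smul_comp,
    Linear.comp_units_smul, smul_smul, smul_smul, ← Int.negOnePow_add, ← Int.negOnePow_add]
  congr 1
  refine congrArg (· • _) (congrArg Int.negOnePow ?_)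
  obtain rfl : r = n + j - k := by omega
  ring

/-- The leading component of a coboundary is the coboundary of the leading component. -/
lemma rowCochain_δ {n m : ℤ} {z : Cochain U V n} (hz : FiltGE m z) (n' : ℤ) (hn : n + 1 = n')
    (j k r r' : ℤ) (hk : k = j + m) (hr : r + k = n + j) (hr' : r + 1 = r') :
    rowCochain (δ n n' z) j k r' (by omega) = δ r r' (rowCochain z j k r hr) := by
  subst hk
  exact rowCochain_δ_of_comp_app z n' hn j (j + m) r r' hr hr'
    (fun p q s hpq => Gr.comp_app_eq_single _ _ j (j + m) (j + m) (m₁ := m) (m₂ := 0)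
      (fun j' h' => hz _ _ _ _ _ h') (fun j' h' => Gr.Hom.app_eq_zero _ _ _ (by omega))
      (by omega) (by omega))
    (fun p q s hqs => Gr.comp_app_eq_single _ _ j j (j + m) (m₁ := 0) (m₂ := m)
      (fun j' h' => Gr.Hom.app_eq_zero _ _ _ (by omega)) (fun j' h' => hz _ _ _ _ _ h')
      (by omega) (by omega))

/-- If the differentials are concentrated in order zero, then taking components of cochains
commutes with the coboundary. -/
lemma rowCochain_δ_of_deg0 (hU : ∀ p q j k, j ≠ k → (U.d p q).app j k = 0)
    (hV : ∀ p q j k, j ≠ k → (V.d p q).app j k = 0) {n : ℤ} (z : Cochain U V n) (n' : ℤ)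
    (hn : n + 1 = n') (j k r r' : ℤ) (hr : r + k = n + j) (hr' : r + 1 = r') :
    rowCochain (δ n n' z) j k r' (by omega) = δ r r' (rowCochain z j k r hr) := by
  refine rowCochain_δ_of_comp_app z n' hn j k r r' hr hr' (fun p q s hpq => ?_)
    (fun p q s hqs => ?_)
  · rw [Gr.comp_app]
    by_cases h : j ≤ k
    · exact Finset.sum_eq_single k (fun l _ hl => by rw [hV _ _ _ _ hl, comp_zero])
        (fun h' => (h' (by simp [h])).elim)
    · rw [Finset.Icc_eq_empty h, Finset.sum_empty, (z.v p q hpq).app_eq_zero _ _ (by omega),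
        zero_comp]
  · rw [Gr.comp_app]
    by_cases h : j ≤ k
    · exact Finset.sum_eq_single j (fun l _ hl => by rw [hU _ _ _ _ hl.symm, zero_comp])
        (fun h' => (h' (by simp [h])).elim)
    · rw [Finset.Icc_eq_empty h, Finset.sum_empty, (z.v q s hqs).app_eq_zero _ _ (by omega),
        comp_zero]

/-- The component of order one of a coboundary. -/
lemma rowCochain_δ_succ {n : ℤ} (z : Cochain U V n) (n' : ℤ) (hn : n + 1 = n')
    (j k r r' : ℤ) (hk : k = j + 1) (hr : r + k = n + j) (hr' : r + 1 = r') :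
    rowCochain (δ n n' z) j k r' (by omega) = δ r r' (rowCochain z j k r hr) +
      n.negOnePow • (rowCochain z j j n rfl).comp
        (rowCochain (Cochain.diff V) j k 0 (by omega)) (by omega) +
      n'.negOnePow • (rowCochain (Cochain.diff U) j k 0 (by omega)).comp
        (rowCochain z k k n rfl) (by omega) := by
  subst hn hk
  obtain rfl : r' = n := by omega
  obtain rfl : r = r' - 1 := by omega
  ext p q hpq
  rw [rowCochain_v, δ_v _ _ rfl z (p + j) (q + (j + 1)) (by omega) (q + j) (p + (j + 1))
      (by omega) (by omega), Cochain.add_v, Cochain.add_v, Cochain.units_smul_v,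
    Cochain.units_smul_v,
    δ_v _ _ hr' _ p q hpq _ _ rfl rfl, Cochain.comp_zero_cochain_v, Cochain.zero_cochain_comp_v,
    rowCochain_v, rowCochain_v, rowCochain_v, rowCochain_v, rowCochain_v, rowCochain_v,
    Gr.add_app, Gr.units_smul_app, Gr.comp_app_succ _ _ j (j + 1) rfl,
    Gr.comp_app_succ _ _ j (j + 1) rfl]
  simp only [Cochain.diff_v, Linear.units_smul_comp, Linear.comp_units_smul, smul_smul,
    smul_add, ← Int.negOnePow_add]
  have aux₁ : ∀ x (hx : x = q + j) (h₁ : p + j + (r' - 1 + 1) = x) ,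
      (z.v (p + j) x (by omega)).app j (j + 1) ≫ (V.d x (q + (j + 1))).app (j + 1) (j + 1) =
      (z.v (p + j) (q + j) (by omega)).app j (j + 1) ≫
        (V.d (q + j) (q + (j + 1))).app (j + 1) (j + 1) := by
    rintro _ rfl _
    rfl
  have aux₂ : ∀ x (hx : x = p + (j + 1)),
      (U.d (p + j) x).app j j ≫ (z.v x (q + (j + 1)) (by omega)).app j (j + 1) =
      (U.d (p + j) (p + (j + 1))).app j j ≫
        (z.v (p + (j + 1)) (q + (j + 1)) (by omega)).app j (j + 1) := by
    rintro _ rfl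
    rfl
  rw [aux₁ (q - 1 + (j + 1)) (by omega) (by omega), aux₂ (p + 1 + j) (by omega)]
  have s₁ : (r' + (p + 1 + j) * (j + 1 - j)).negOnePow =
      ((p + j) * (j + 1 - j) + (r' + 1)).negOnePow := by
    congr 1
    ring
  have s₂ : (r' + ((q + j) * (j + 1 - j) + (p + j) * (j - j))).negOnePow =
      ((p + j) * (j + 1 - j)).negOnePow := by
    apply (Int.negOnePow_eq_iff _ _).2
    subst hpq
    have e : r' + ((p + r' + j) * (j + 1 - j) + (p + j) * (j - j)) - (p + j) * (j + 1 - j) =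
      2 * r' := by ring
    rw [e]
    exact even_two_mul _
  have s₃ : (r' + 1 + ((p + (j + 1)) * (j + 1 - (j + 1)) + (p + j) * (j + 1 - j))).negOnePow =
      ((p + j) * (j + 1 - j) + (r' + 1)).negOnePow := by
    congr 1
    ring
  rw [s₁, s₂, s₃]
  abel

/-- Every family of cochains between rows is the leading part of a cochain. -/
lemma exists_rowCochain_eq {n : ℤ} (m r : ℤ) (hr : r + m = n)
    (ω : ∀ j k, k = j + m → Cochain (grRow U j) (grRow V k) r) (hm : 0 ≤ m) :
    ∃ w : Cochain U V n, FiltGE m w ∧ ∀ j k (hk : k = j + m),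
      rowCochain w j k r (by omega) = ω j k hk := by
  let w : Cochain U V n := Cochain.mk fun p q hpq =>
    { app := fun j k =>
        if h : k = j + m then
          (p * m).negOnePow • (eqToHom (by
              change (U.X p).obj j = (U.X (p - j + j)).obj j; rw [sub_add_cancel]) ≫
            (ω j k h).v (p - j) (q - k) (by omega) ≫ eqToHom (by
              change (V.X (q - k + k)).obj k = _; rw [sub_add_cancel]))
        else 0
      app_eq_zero := fun j k h => dif_neg (by omega) }
  refine ⟨w, fun p q hpq j k h => dif_neg (by omega), fun j k hk => ?_⟩
  ext p q hpq
  rw [rowCochain_v]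
  have e : ∀ p' q', ∀ hp : p' = p, ∀ hq : q' = q, ∀ h' : p' + r = q', ∀ e1 e2,
      (eqToHom e1 ≫ (ω j k hk).v p' q' h' ≫ eqToHom e2 :
        (U.X (p + j)).obj j ⟶ (V.X (q + k)).obj k) = (ω j k hk).v p q hpq := by
    rintro _ _ rfl rfl _ _ _
    rw [eqToHom_refl, eqToHom_refl]
    exact (Category.id_comp _).trans (Category.comp_id _)
  refine (congrArg (((p + j) * (k - j)).negOnePow • ·) (dif_pos hk)).trans ?_
  dsimp only
  rw [e _ _ (by omega) (by omega), smul_smul, ← Int.negOnePow_add,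
    Int.negOnePow_even, one_smul]
  rw [hk, add_sub_cancel_left, ← two_mul]
  exact even_two_mul _

/-- Successive approximation: a sequence of cochains whose differences have increasing order
converges. -/
lemma exists_limit {n : ℤ} (m : ℕ) (P : ℕ → Cochain U V n → Prop) (z₀ : Cochain U V n)
    (h₀ : P 0 z₀)
    (step : ∀ s z, P s z → ∃ z', P (s + 1) z' ∧ FiltGE (m + s : ℤ) (z' - z)) :
    ∃ z, ∀ s : ℕ, ∃ z', P s z' ∧ FiltGE (m + s : ℤ) (z - z') := by
  choose! nxt hnxt hfilt using step
  let y : ℕ → Cochain U V n := fun s => Nat.rec z₀ nxt s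
  have hy : ∀ s, P s (y s) := fun s => by
    induction s with
    | zero => exact h₀
    | succ s ih => exact hnxt s _ ih
  have hd : ∀ s t : ℕ, FiltGE (m + s : ℤ) (y (s + t) - y s) := fun s t => by
    induction t with
    | zero => simpa using FiltGE.zero _
    | succ t ih =>
      have := (((hfilt (s + t) _ (hy _)).mono (m' := m + s) (by push_cast; omega)).add ih)
      rwa [sub_add_sub_cancel] at this
  -- the components of order `k - j` do not change from the term `k - j + 1` of the sequence on
  refine ⟨Cochain.mk fun p q hpq =>
    { app := fun j k => ((y (k - j + 1).toNat).v p q hpq).app j k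
      app_eq_zero := fun j k h => Gr.Hom.app_eq_zero _ _ _ h }, fun s => ⟨y s, hy s, ?_⟩⟩
  intro p q hpq j k hk
  rw [Cochain.sub_v, Gr.sub_app, Cochain.mk_v]
  change ((y (k - j + 1).toNat).v p q hpq).app j k - _ = 0
  rw [← Gr.sub_app, ← Cochain.sub_v]
  rcases le_total s (k - j + 1).toNat with h | h
  · obtain ⟨t, ht⟩ := Nat.exists_eq_add_of_le h
    rw [ht]
    exact hd s t p q hpq j k hk
  · obtain ⟨t, ht⟩ := Nat.exists_eq_add_of_le h
    rw [ht, ← neg_sub, Cochain.neg_v, Gr.neg_app, hd _ t p q hpq j k (by omega), neg_zero]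

/-- The cocycles of degree `r` from `F` to `G` are coboundaries. -/
def IsAcyclicHom (F G : CochainComplex A ℤ) (r : ℤ) : Prop :=
  ∀ z : Cochain F G r, δ r (r + 1) z = 0 → ∃ w : Cochain F G (r - 1), δ (r - 1) r w = z

/-- If the leading component of `z` is a cocycle of rows, in a degree where cocycles are
coboundaries, then `z` has higher order up to a coboundary. -/
lemma exists_filtGE_succ {n : ℤ} {m : ℤ} (hm : 0 ≤ m) {z : Cochain U V n} (hz : FiltGE m z)
    {r : ℤ} (hr : r + m = n) (hδ : FiltGE (m + 1) (δ n (n + 1) z))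
    (hA : ∀ j k, k = j + m → IsAcyclicHom (grRow U j) (grRow V k) r) :
    ∃ w : Cochain U V (n - 1), FiltGE m w ∧ FiltGE (m + 1) (z - δ (n - 1) n w) := by
  have h : ∀ j k (hk : k = j + m), ∃ w : Cochain (grRow U j) (grRow V k) (r - 1),
      δ (r - 1) r w = rowCochain z j k r (by omega) := fun j k hk => by
    refine hA j k hk _ ?_
    rw [← rowCochain_δ hz _ rfl _ _ _ _ hk _ rfl]
    exact hδ.rowCochain_eq_zero _ _ _ _ (by omega)
  choose ω hω using h
  obtain ⟨w, hw, hwω⟩ := exists_rowCochain_eq (U := U) (V := V) (n := n - 1) m (r - 1)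
    (by omega) ω hm
  refine ⟨w, hw, (hz.sub (hw.δ n)).succ hr (fun j k hk => ?_)⟩
  rw [rowCochain_sub, rowCochain_δ hw n (by omega) j k (r - 1) r hk (by omega) (by omega),
    hwω j k hk, hω j k hk, sub_self]

/-- A cocycle of order at least `m` is a coboundary if the cocycles of the corresponding degree
between the rows are. -/
lemma exists_δ_eq {n : ℤ} (n' : ℤ) (hn : n' = n - 1) (m : ℕ) {z : Cochain U V n}
    (hz : FiltGE (m : ℤ) z) (hδ : δ n (n + 1) z = 0)
    (hA : ∀ j k r : ℤ, j + m ≤ k → r + k = n + j → IsAcyclicHom (grRow U j) (grRow V k) r) :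
    ∃ w : Cochain U V n', FiltGE (m : ℤ) w ∧ δ n' n w = z := by
  subst hn
  obtain ⟨w, hw⟩ := exists_limit (U := U) (V := V) (n := n - 1) m
    (fun s w => FiltGE (m : ℤ) w ∧ FiltGE (m + s : ℤ) (z - δ (n - 1) n w)) 0
    ⟨FiltGE.zero _, by simpa using hz⟩
    (fun s w ⟨hw₀, hw⟩ => by
      obtain ⟨w', hw', h⟩ := exists_filtGE_succ (by omega) hw (r := n - (m + s)) (by omega)
        (by rw [δ_sub, hδ, δ_δ, sub_zero]; exact FiltGE.zero _)
        (fun j k hk => hA j k (n - (m + s)) (by omega) (by omega))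
      refine ⟨w + w', ⟨hw₀.add (hw'.mono (by omega)), ?_⟩, by simpa using hw'⟩
      rw [δ_add, ← sub_sub]
      simpa [add_assoc] using h)
  refine ⟨w, ?_, (sub_eq_zero.1 (eq_zero_of_filtGE (fun s => ?_))).symm⟩
  · obtain ⟨w', ⟨hw', -⟩, h⟩ := hw 0
    simpa using hw'.add (h.mono (m' := (m : ℤ)) (by omega))
  obtain ⟨w', ⟨-, hw'⟩, h⟩ := hw s
  have := (hw'.sub (h.δ n)).mono (m' := (s : ℤ)) (by omega)
  simpa [δ_sub] using this

end Rows

/-! ### Chain maps and the rows of complexes -/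

section Rows

variable {A : Type u} [Category.{v} A] [Preadditive A]

variable {U V W : CochainComplex (Gr A) ℤ}

/-- The chain map `f_0` between the `j`-th rows. -/
def rowMap (f : U ⟶ V) (j : ℤ) : grRow U j ⟶ grRow V j where
  f := fun p => (f.f (p + j)).app j j
  comm' := fun p q _ => by rw [← Gr.comp_app_self, f.comm, Gr.comp_app_self]

lemma rowMap_id (j : ℤ) : rowMap (𝟙 U) j = 𝟙 (grRow U j) := by
  ext p
  exact Gr.id_app_self _ _

lemma rowMap_comp (f : U ⟶ V) (g : V ⟶ W) (j : ℤ) :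
    rowMap (f ≫ g) j = rowMap f j ≫ rowMap g j := by
  ext p
  exact Gr.comp_app_self _ _ _

lemma rowMap_add (f g : U ⟶ V) (j : ℤ) : rowMap (f + g) j = rowMap f j + rowMap g j := rfl

lemma rowMap_sub (f g : U ⟶ V) (j : ℤ) : rowMap (f - g) j = rowMap f j - rowMap g j := by
  ext p
  exact Gr.sub_app _ _ _ _

lemma rowCochain_ofHom (f : U ⟶ V) (j : ℤ) :
    rowCochain (Cochain.ofHom f) j j 0 rfl = Cochain.ofHom (rowMap f j) := by
  ext p
  rw [rowCochain_v, sub_self, mul_zero, Int.negOnePow_zero, one_smul]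
  exact (congrArg (fun g : U.X (p + j) ⟶ V.X (p + j) => g.app j j)
    (Cochain.ofHom_v f (p + j))).trans (Cochain.ofHom_v (rowMap f j) p).symm

variable (U) in
/-- The chain map `(-1)^i d_1` between consecutive rows. -/
@[simps]
def rowD (j k : ℤ) (h : j + 1 = k) : grRow U j ⟶ grRow U k where
  f p := (p + j).negOnePow • (U.d (p + j) (p + k)).app j k
  comm' p q hpq := by
    obtain rfl : p + 1 = q := hpq
    subst h
    have h := congrArg (fun g => Gr.Hom.app g j (j + 1))
      (U.d_comp_d (p + j) (p + (j + 1)) (p + 1 + (j + 1)))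
    rw [Gr.comp_app_succ _ _ j _ rfl, Gr.zero_app] at h
    have aux : ∀ x (hx : x = p + (j + 1)), (U.d (p + j) x).app j j ≫
        (x.negOnePow • (U.d x (p + 1 + (j + 1))).app j (j + 1)) =
        (p + j).negOnePow • (U.d (p + j) (p + (j + 1))).app j (j + 1) ≫
          (U.d (p + (j + 1)) (p + 1 + (j + 1))).app (j + 1) (j + 1) := by
      rintro _ rfl
      rw [Linear.comp_units_smul, eq_neg_of_add_eq_zero_left h, ← add_assoc p j 1, Int.negOnePow_succ,
        Units.neg_smul, smul_neg, neg_neg]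
    rw [Linear.units_smul_comp]
    exact (aux _ (by ring)).symm

lemma rowCochain_diff (j k : ℤ) (h : j + 1 = k) :
    rowCochain (Cochain.diff U) j k 0 (by omega) = Cochain.ofHom (rowD U j k h) := by
  ext p
  rw [rowCochain_v, Cochain.ofHom_v, Cochain.diff_v, rowD_f, ← h, add_sub_cancel_left, mul_one]

/-- The cocycles of nonzero degree between the rows of `U` and those of `V` are coboundaries. -/
def OrthogonalRows (U V : CochainComplex (Gr A) ℤ) : Prop :=
  ∀ j k r : ℤ, r ≠ 0 → IsAcyclicHom (grRow U j) (grRow V k) r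

/-- Chain maps between the rows which commute with `d_1` up to homotopy are the components `f_0` of
a chain map. -/
lemma exists_rowMap_eq (H : OrthogonalRows U V) (a : ∀ j, grRow U j ⟶ grRow V j)
    (ha : ∀ j k (h : j + 1 = k), Nonempty (Homotopy (a j ≫ rowD V j k h) (rowD U j k h ≫ a k))) :
    ∃ f : U ⟶ V, ∀ j, rowMap f j = a j := by
  -- any cochain `f₀` with the given components of order zero, which are chain maps
  obtain ⟨f₀, -, hf₀⟩ := exists_rowCochain_eq (U := U) (V := V) (n := 0) 0 0 rfl
    (fun j k h => Cochain.ofHom (a j) |>.comp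
      (Cochain.ofHom (eqToHom (by rw [h, add_zero]))) (add_zero 0)) le_rfl
  replace hf₀ : ∀ j, rowCochain f₀ j j 0 rfl = Cochain.ofHom (a j) := fun j => by
    simpa using hf₀ j j (by omega)
  have h₁ : FiltGE 1 (δ 0 1 f₀) := by
    refine FiltGE.succ (m := 0) (FiltGE.zero_order _) (r := 1) rfl (fun j k hk => ?_)
    obtain rfl : j = k := by omega
    rw [rowCochain_δ (m := 0) (FiltGE.zero_order _) 1 rfl j j 0 1 hk rfl rfl, hf₀, δ_ofHom]
  -- the homotopies, up to sign, are the components of order one; `w₁` corrects those of `f₀`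
  choose ω hω using fun j k (h : k = j + 1) =>
    Twist.exists_cochain (Homotopy.equivSubZero (ha j k h.symm).some)
  obtain ⟨w₁, hw₁, hw₁ω⟩ := exists_rowCochain_eq (U := U) (V := V) (n := 0) 1 (-1) rfl
    (fun j k h => rowCochain f₀ j k (-1) (by omega) + ω j k h) (by omega)
  have h₂ : FiltGE 2 (δ 0 1 (f₀ - w₁)) := by
    rw [δ_sub]
    refine FiltGE.succ (m := 1) (h₁.sub (hw₁.δ 1)) (r := 0) rfl (fun j k hk => ?_)
    rw [rowCochain_sub, rowCochain_δ hw₁ 1 rfl j k (-1) 0 hk (by omega) rfl, hw₁ω _ _ hk,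
      rowCochain_δ_succ f₀ 1 rfl j k (-1) 0 hk (by omega) rfl, hf₀, hf₀, δ_add, hω,
      rowCochain_diff j k hk.symm, rowCochain_diff j k hk.symm, ← Cochain.ofHom_comp,
      ← Cochain.ofHom_comp, Cochain.ofHom_sub]
    simp only [Int.negOnePow_zero, Int.negOnePow_one, one_smul, Units.neg_smul]
    abel
  -- in orders at least two the obstructions lie in negative row degrees
  obtain ⟨w, hw, hwδ⟩ := exists_δ_eq (U := U) (V := V) (n := 1) 0 rfl 2 h₂ (δ_δ _ _ _ _)
    (fun j k r _ _ => H j k r (by omega))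
  let F : Cocycle U V 0 := Cocycle.mk (f₀ - w₁ - w) 1 rfl (by
    rw [δ_sub, sub_eq_zero]
    exact hwδ.symm)
  refine ⟨Cocycle.homOf F, fun j => Cochain.ofHom_injective ?_⟩
  rw [← rowCochain_ofHom, Cocycle.cochain_ofHom_homOf_eq_coe]
  change rowCochain (f₀ - w₁ - w) j j 0 rfl = _
  rw [rowCochain_sub, rowCochain_sub, hf₀, hw₁.rowCochain_eq_zero _ _ _ _ (by omega), sub_zero,
    FiltGE.rowCochain_eq_zero (m := 2) hw _ _ _ _ (by omega), sub_zero]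

/-- Chain maps whose components `f_0` are homotopic are homotopic. -/
lemma nonempty_homotopy_of_rows (H : OrthogonalRows U V) (f g : U ⟶ V)
    (h : ∀ j, Nonempty (Homotopy (rowMap f j) (rowMap g j))) :
    Nonempty (Homotopy f g) := by
  choose ω hω using fun j => Twist.exists_cochain (Homotopy.equivSubZero (h j).some)
  obtain ⟨w₀, hw₀, hw₀ω⟩ := exists_rowCochain_eq (U := U) (V := V) (n := -1) 0 (-1) rfl
    (fun j k h => (ω j).comp
      (Cochain.ofHom (eqToHom (by rw [h, add_zero]))) (add_zero (-1))) le_rfl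
  have h₁ : FiltGE 1 (Cochain.ofHom (f - g) - δ (-1) 0 w₀) := by
    refine FiltGE.succ (m := 0) (FiltGE.zero_order _) (r := 0) rfl (fun j k hk => ?_)
    obtain rfl : j = k := by omega
    rw [rowCochain_sub, rowCochain_ofHom, rowCochain_δ hw₀ 0 rfl j j (-1) 0 hk rfl rfl,
      hw₀ω j j hk, eqToHom_refl, Cochain.comp_id, hω, rowMap_sub, sub_self]
  obtain ⟨w, -, hw⟩ := exists_δ_eq (U := U) (V := V) (n := 0) (-1) rfl 1 h₁ (by simp [δ_δ])
    (fun j k r _ _ => H j k r (by omega))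
  refine ⟨Homotopy.equivSubZero.symm ((Cochain.equivHomotopy _ _).symm ⟨w + w₀, ?_⟩)⟩
  rw [Cochain.ofHom_zero, add_zero, δ_add]
  exact (sub_eq_iff_eq_add.1 hw.symm)

/-- The degree one component `f_1` of a chain map is a homotopy between `f_0 d_1` and `d_1 f_0`. -/
lemma nonempty_homotopy_map_comp_rowD (f : U ⟶ V) (j k : ℤ) (h : j + 1 = k) :
    Nonempty (Homotopy (rowMap f j ≫ rowD V j k h)
      (rowD U j k h ≫ rowMap f k)) := by
  refine ⟨Homotopy.equivSubZero.symm ((Cochain.equivHomotopy _ _).symm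
    ⟨-rowCochain (Cochain.ofHom f) j k (-1) (by omega), ?_⟩)⟩
  have h := rowCochain_δ_succ (Cochain.ofHom f) 1 rfl j k (-1) 0 h.symm (by omega) rfl
  rw [δ_ofHom, rowCochain_zero, rowCochain_ofHom, rowCochain_ofHom, rowCochain_diff _ _ (by omega),
    rowCochain_diff _ _ (by omega), ← Cochain.ofHom_comp, ← Cochain.ofHom_comp] at h
  rw [Cochain.ofHom_zero, add_zero, Cochain.ofHom_sub, δ_neg, eq_comm,
    neg_eq_iff_add_eq_zero, h]
  simp
  abel

end Rows

/-! ### The rows of `U(1)[1]` and of `cone(f η)` -/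

section Translation

variable {A : Type u} [Category.{v} A] [Preadditive A]

/-- The identification of the components of equal degrees of a complex over `gr A`. -/
def castX (U : CochainComplex (Gr A) ℤ) (k : ℤ) {a b : ℤ} (h : a = b) :
    (U.X a).obj k ⟶ (U.X b).obj k :=
  eqToHom (by rw [h])

lemma castX_comp (U : CochainComplex (Gr A) ℤ) (k : ℤ) {a b : ℤ} (h : a = b) (h' : b = a) :
    castX U k h ≫ castX U k h' = 𝟙 _ := by
  simp [castX]

lemma d_app_comp_castX (U : CochainComplex (Gr A) ℤ) {a a' b b' : ℤ} (k l : ℤ) (ha : a = a')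
    (hb : b = b') :
    (U.d a b).app k l ≫ castX U l hb = castX U k ha ≫ (U.d a' b').app k l := by
  subst ha hb
  simp [castX]

lemma map_app_comp_castX {U V : CochainComplex (Gr A) ℤ} (f : U ⟶ V) {a a' : ℤ} (k l : ℤ)
    (ha : a = a') :
    (f.f a).app k l ≫ castX V l ha = castX U k ha ≫ (f.f a').app k l := by
  subst ha
  simp [castX]

lemma Gr.eta_comp_app {X Y : Gr A} (g : X ⟶ Y) (i j : ℤ) :
    (Gr.eta.app X ≫ g).app i j = g.app (i + 1) j := by
  rw [Gr.comp_app]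
  change ∑ k ∈ Finset.Icc i j, Gr.etaComp X i k ≫ g.app k j = _
  by_cases h : i + 1 ≤ j
  · rw [Finset.sum_eq_single (i + 1)
      (fun k _ hk => by rw [Gr.etaComp_ne _ hk.symm, zero_comp])
      (fun h' => (h' (Finset.mem_Icc.2 ⟨by omega, h⟩)).elim), Gr.etaComp_self]
    exact Category.id_comp _
  · rw [g.app_eq_zero _ _ (by omega), Finset.sum_eq_zero]
    intro k hk
    rw [Finset.mem_Icc] at hk
    rw [Gr.etaComp_ne _ (by omega), zero_comp]

variable {Λ : Type u} [Ring Λ]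

lemma translation_d_app (U : CochainComplex (Gr (ProjMod Λ)) ℤ) (a b j k : ℤ) :
    (((grTwist Λ).translationCplx.obj U).d a b).app j k =
      -(U.d (a + 1) (b + 1)).app (j + 1) (k + 1) := by
  change ((Int.negOnePow 1) • ((grTwist Λ).onCplx.obj U).d (a + 1) (b + 1)).app j k = _
  rw [Int.negOnePow_one, Units.neg_smul, one_smul]
  rfl

/-- The `j`-th row of `U(1)[1]` is isomorphic to the row `j + 1` of `U`, by `(-1)^i` in degree
`(i, j)`. -/
def translationRowIso (U : CochainComplex (Gr (ProjMod Λ)) ℤ) (j : ℤ) :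
    grRow ((grTwist Λ).translationCplx.obj U) j ≅ grRow U (j + 1) where
  hom :=
    { f := fun p => (p + j).negOnePow •
        castX U (j + 1) (show p + j + 1 = p + (j + 1) by ring)
      comm' := fun p q hpq => by
        obtain rfl : p + 1 = q := hpq
        have h : ((p + j).negOnePow • castX U (j + 1) (show p + j + 1 = p + (j + 1) by ring)) ≫
              (U.d (p + (j + 1)) (p + 1 + (j + 1))).app (j + 1) (j + 1) =
            (-(U.d (p + j + 1) (p + 1 + j + 1)).app (j + 1) (j + 1)) ≫ ((p + 1 + j).negOnePow •
              castX U (j + 1) (show p + 1 + j + 1 = p + 1 + (j + 1) by ring)) := by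
          rw [Linear.units_smul_comp, Preadditive.neg_comp, Linear.comp_units_smul,
            d_app_comp_castX U _ _ (show p + j + 1 = p + (j + 1) by ring),
            show (p + 1 + j).negOnePow = -(p + j).negOnePow by
              rw [← Int.negOnePow_succ]; congr 1; ring, Units.neg_smul, neg_neg]
        exact h.trans (congrArg (fun x : (U.X (p + j + 1)).obj (j + 1) ⟶
          (U.X (p + 1 + j + 1)).obj (j + 1) => x ≫ _) (translation_d_app U _ _ j j).symm) }
  inv :=
    { f := fun p => (p + j).negOnePow •
        castX U (j + 1) (show p + (j + 1) = p + j + 1 by ring)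
      comm' := fun p q hpq => by
        obtain rfl : p + 1 = q := hpq
        have h : ((p + j).negOnePow • castX U (j + 1) (show p + (j + 1) = p + j + 1 by ring)) ≫
              (-(U.d (p + j + 1) (p + 1 + j + 1)).app (j + 1) (j + 1)) =
            (U.d (p + (j + 1)) (p + 1 + (j + 1))).app (j + 1) (j + 1) ≫ ((p + 1 + j).negOnePow •
              castX U (j + 1) (show p + 1 + (j + 1) = p + 1 + j + 1 by ring)) := by
          rw [Linear.units_smul_comp, Preadditive.comp_neg, Linear.comp_units_smul,
            d_app_comp_castX U _ _ (show p + (j + 1) = p + j + 1 by ring),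
            show (p + 1 + j).negOnePow = -(p + j).negOnePow by
              rw [← Int.negOnePow_succ]; congr 1; ring, Units.neg_smul, smul_neg]
        exact (congrArg (fun x : (U.X (p + j + 1)).obj (j + 1) ⟶
          (U.X (p + 1 + j + 1)).obj (j + 1) => _ ≫ x) (translation_d_app U _ _ j j)).trans h }
  hom_inv_id := by
    refine HomologicalComplex.hom_ext _ _ (fun p => ?_)
    have h : ((p + j).negOnePow • castX U (j + 1) (show p + j + 1 = p + (j + 1) by ring)) ≫
        ((p + j).negOnePow • castX U (j + 1) (show p + (j + 1) = p + j + 1 by ring)) = 𝟙 _ := by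
      rw [Linear.units_smul_comp, Linear.comp_units_smul, smul_smul, castX_comp, Int.units_mul_self,
        one_smul]
    exact h
  inv_hom_id := by
    refine HomologicalComplex.hom_ext _ _ (fun p => ?_)
    have h : ((p + j).negOnePow • castX U (j + 1) (show p + (j + 1) = p + j + 1 by ring)) ≫
        ((p + j).negOnePow • castX U (j + 1) (show p + j + 1 = p + (j + 1) by ring)) = 𝟙 _ := by
      rw [Linear.units_smul_comp, Linear.comp_units_smul, smul_smul, castX_comp, Int.units_mul_self,
        one_smul]
    exact h

lemma rowMap_translation_comp {U V : CochainComplex (Gr (ProjMod Λ)) ℤ} (f : U ⟶ V) (j : ℤ) :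
    rowMap ((grTwist Λ).translationCplx.map f) j ≫ (translationRowIso V j).hom =
      (translationRowIso U j).hom ≫ rowMap f (j + 1) := by
  refine HomologicalComplex.hom_ext _ _ (fun p => ?_)
  change (f.f (p + j + 1)).app (j + 1) (j + 1) ≫ ((p + j).negOnePow • castX V (j + 1) _) =
    ((p + j).negOnePow • castX U (j + 1) _) ≫ (f.f (p + (j + 1))).app (j + 1) (j + 1)
  rw [Linear.units_smul_comp, Linear.comp_units_smul, map_app_comp_castX]

/-- The sign is that of the differential of a shifted complex over `Sum T`. -/
lemma rowD_translation_comp (U : CochainComplex (Gr (ProjMod Λ)) ℤ) (j k : ℤ) (h : j + 1 = k) :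
    rowD ((grTwist Λ).translationCplx.obj U) j k h ≫ (translationRowIso U k).hom =
      -((translationRowIso U j).hom ≫ rowD U (j + 1) (k + 1) (by omega)) := by
  subst h
  refine HomologicalComplex.hom_ext _ _ (fun p => ?_)
  rw [HomologicalComplex.comp_f, rowD_f, translation_d_app]
  change ((p + j).negOnePow • -(U.d (p + j + 1) (p + (j + 1) + 1)).app (j + 1) (j + 1 + 1)) ≫
      ((p + (j + 1)).negOnePow • castX U (j + 1 + 1) _) =
    -(((p + j).negOnePow • castX U (j + 1) _) ≫
      ((p + (j + 1)).negOnePow • (U.d (p + (j + 1)) (p + (j + 1 + 1))).app (j + 1) (j + 1 + 1)))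
  rw [Linear.units_smul_comp, Linear.comp_units_smul, Linear.units_smul_comp,
    Linear.comp_units_smul, Preadditive.neg_comp,
    d_app_comp_castX U _ _ (show p + j + 1 = p + (j + 1) by ring), smul_neg, smul_neg]

section Cone

variable {U V : CochainComplex (Gr (ProjMod Λ)) ℤ} (f : U ⟶ V)

/-- The cone of `f η_U`. -/
abbrev etaCone : CochainComplex (Gr (ProjMod Λ)) ℤ := mappingCone ((grTwist Λ).ηCplx.app U ≫ f)

/-- The projection `cone(f η_U) ⟶ U(1)[1]`. -/
abbrev etaConeδ : etaCone f ⟶ (grTwist Λ).translationCplx.obj U :=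
  (mappingCone.triangle ((grTwist Λ).ηCplx.app U ≫ f)).mor₃

/-- The inclusion `V ⟶ cone(f η_U)`. -/
abbrev etaConeInr : V ⟶ etaCone f := mappingCone.inr ((grTwist Λ).ηCplx.app U ≫ f)

lemma eta_comp_f_app (i j k : ℤ) :
    (((grTwist Λ).ηCplx.app U ≫ f).f i).app j k = (f.f i).app (j + 1) k :=
  Gr.eta_comp_app _ _ _

lemma etaConeδ_f (i : ℤ) : (etaConeδ f).f i =
    -(mappingCone.fst ((grTwist Λ).ηCplx.app U ≫ f)).1.v i (i + 1) rfl := by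
  dsimp [etaConeδ, mappingCone.triangle]
  simp [Cochain.rightShift_v _ 1 0 (zero_add 1) i i (add_zero i) (i + 1) rfl]
  exact congrArg (- ·) (Category.comp_id _)

lemma etaConeδ_app (i j k : ℤ) : ((etaConeδ f).f i).app j k =
    (-((mappingCone.fst ((grTwist Λ).ηCplx.app U ≫ f)).1.v i (i + 1) rfl).app j k :
      ((etaCone f).X i).obj j ⟶ (((grTwist Λ).onCplx.obj U).X (i + 1)).obj k) :=
  congrArg (fun x : (etaCone f).X i ⟶ ((grTwist Λ).onCplx.obj U).X (i + 1) =>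
    Gr.Hom.app x j k)
    (etaConeδ_f f i)

lemma eta_comp_f_app_self (i j : ℤ) :
    (((grTwist Λ).ηCplx.app U ≫ f).f i).app j j = 0 :=
  (eta_comp_f_app f i j j).trans (Gr.Hom.app_eq_zero _ _ _ (by omega))

/-- The inclusion of the row of `U(1)[1]` into the row of the cone. It is a chain map since `f η_U`
has no component of order zero. -/
def rowInl (j : ℤ) : grRow ((grTwist Λ).translationCplx.obj U) j ⟶ grRow (etaCone f) j where
  f p := ((mappingCone.inl ((grTwist Λ).ηCplx.app U ≫ f)).v (p + j + 1) (p + j) (by omega)).app j j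
  comm' p q hpq := by
    obtain rfl : p + 1 = q := hpq
    have aux : ∀ x (hx : x = p + j + 1),
        ((mappingCone.inl ((grTwist Λ).ηCplx.app U ≫ f)).v (p + j + 1) (p + j) (by omega)).app j j ≫
          ((etaCone f).d (p + j) x).app j j =
        (-(((grTwist Λ).onCplx.obj U).d (p + j + 1) (x + 1)).app j j) ≫
          ((mappingCone.inl ((grTwist Λ).ηCplx.app U ≫ f)).v (x + 1) x (by omega)).app j j := by
      rintro _ rfl
      rw [← Gr.comp_app_self, mappingCone.inl_v_d _ _ _ (p + j + 1 + 1) (by omega) (by omega),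
        Gr.sub_app, Gr.comp_app_self, eta_comp_f_app_self, zero_comp, zero_sub,
        Gr.comp_app_self, Preadditive.neg_comp]
    refine (aux (p + 1 + j) (by ring)).trans ?_
    exact congrArg (fun x : (U.X (p + j + 1)).obj (j + 1) ⟶
          (U.X (p + 1 + j + 1)).obj (j + 1) => x ≫
          ((mappingCone.inl ((grTwist Λ).ηCplx.app U ≫ f)).v (p + 1 + j + 1) (p + 1 + j)
            (by omega)).app j j) (translation_d_app U _ _ j j).symm

/-- The projection of the row of the cone to the row of `V`. -/
def rowSnd (j : ℤ) : grRow (etaCone f) j ⟶ grRow V j where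
  f p := ((mappingCone.snd ((grTwist Λ).ηCplx.app U ≫ f)).v (p + j) (p + j) (by omega)).app j j
  comm' p q hpq := by
    obtain rfl : p + 1 = q := hpq
    rw [← Gr.comp_app_self, ← Gr.comp_app_self,
      mappingCone.d_snd_v _ (p + j) (p + 1 + j) (by omega), Gr.add_app, Gr.comp_app_self,
      Gr.comp_app_self, eta_comp_f_app_self, comp_zero, zero_add]

lemma rowInl_comp_δ (j : ℤ) : rowInl f j ≫ rowMap (etaConeδ f) j = -𝟙 _ := by
  refine HomologicalComplex.hom_ext _ _ (fun p => ?_)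
  change ((mappingCone.inl ((grTwist Λ).ηCplx.app U ≫ f)).v (p + j + 1) (p + j) (by omega)).app j j ≫
    ((etaConeδ f).f (p + j)).app j j = -𝟙 _
  refine (congrArg (fun x : ((etaCone f).X (p + j)).obj j ⟶
    (((grTwist Λ).onCplx.obj U).X (p + j + 1)).obj j =>
      ((mappingCone.inl ((grTwist Λ).ηCplx.app U ≫ f)).v (p + j + 1) (p + j)
        (by omega)).app j j ≫ x) (etaConeδ_app f (p + j) j j)).trans ?_
  rw [Preadditive.comp_neg, ← Gr.comp_app_self, mappingCone.inl_v_fst_v, Gr.id_app_self]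

lemma inr_comp_rowSnd (j : ℤ) : rowMap (etaConeInr f) j ≫ rowSnd f j = 𝟙 _ := by
  refine HomologicalComplex.hom_ext _ _ (fun p => ?_)
  change ((etaConeInr f).f (p + j)).app j j ≫
    ((mappingCone.snd ((grTwist Λ).ηCplx.app U ≫ f)).v (p + j) (p + j) (by omega)).app j j = 𝟙 _
  rw [← Gr.comp_app_self, mappingCone.inr_f_snd_v, Gr.id_app_self]

lemma inr_comp_rowMap_δ (j : ℤ) : rowMap (etaConeInr f) j ≫ rowMap (etaConeδ f) j = 0 := by
  rw [← rowMap_comp]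
  exact congrArg (fun g => rowMap g j)
    (mappingCone.inr_triangleδ ((grTwist Λ).ηCplx.app U ≫ f))

lemma rowInl_comp_rowSnd (j : ℤ) : rowInl f j ≫ rowSnd f j = 0 := by
  refine HomologicalComplex.hom_ext _ _ (fun p => ?_)
  change ((mappingCone.inl ((grTwist Λ).ηCplx.app U ≫ f)).v (p + j + 1) (p + j) (by omega)).app j j ≫
    ((mappingCone.snd ((grTwist Λ).ηCplx.app U ≫ f)).v (p + j) (p + j) (by omega)).app j j = 0
  rw [← Gr.comp_app_self, mappingCone.inl_v_snd_v, Gr.zero_app]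

/-- The rows of the cone are direct sums; the sign in the first summand is that of
`rowInl_comp_δ`. -/
lemma etaCone_row_total (j : ℤ) : -(rowMap (etaConeδ f) j ≫ rowInl f j) +
    rowSnd f j ≫ rowMap (etaConeInr f) j = 𝟙 _ := by
  refine HomologicalComplex.hom_ext _ _ (fun p => ?_)
  change -(((etaConeδ f).f (p + j)).app j j ≫
    ((mappingCone.inl ((grTwist Λ).ηCplx.app U ≫ f)).v (p + j + 1) (p + j) (by omega)).app j j) +
    ((mappingCone.snd ((grTwist Λ).ηCplx.app U ≫ f)).v (p + j) (p + j) (by omega)).app j j ≫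
    ((etaConeInr f).f (p + j)).app j j = 𝟙 _
  have h := congrArg (fun g => Gr.Hom.app g j j)
    (mappingCone.id_X ((grTwist Λ).ηCplx.app U ≫ f) (p + j) (p + j + 1) rfl)
  rw [Gr.add_app, Gr.comp_app_self, Gr.comp_app_self, Gr.id_app_self] at h
  refine Eq.trans (congrArg₂ (· + ·) ?_ rfl) h
  refine (congrArg (fun x : ((etaCone f).X (p + j)).obj j ⟶
    (((grTwist Λ).onCplx.obj U).X (p + j + 1)).obj j =>
      -(x ≫ ((mappingCone.inl ((grTwist Λ).ηCplx.app U ≫ f)).v (p + j + 1) (p + j)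
        (by omega)).app j j)) (etaConeδ_app f (p + j) j j)).trans ?_
  rw [Preadditive.neg_comp, neg_neg]

/-- The projections of the rows of the cone to those of `V` commute with `d_1` up to the component
`f_0` of the differential of the cone and a homotopy. -/
lemma nonempty_homotopy_rowSnd (j : ℤ) :
    Nonempty (Homotopy (rowSnd f j ≫ rowD V j (j + 1) rfl -
      rowMap (etaConeδ f) j ≫ (translationRowIso U j).hom ≫ rowMap f (j + 1))
      (rowD (etaCone f) j (j + 1) rfl ≫ rowSnd f (j + 1))) := by
  let s := mappingCone.snd ((grTwist Λ).ηCplx.app U ≫ f)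
  have hs : ∀ k, rowCochain s k k 0 rfl = Cochain.ofHom (rowSnd f k) := fun k => by
    refine Cochain.ext₀ _ _ (fun p => ?_)
    rw [rowCochain_v, Cochain.ofHom_v, sub_self, mul_zero, Int.negOnePow_zero, one_smul]
    rfl
  have h := rowCochain_δ_succ s 1 rfl j (j + 1) (-1) 0 rfl (by omega) rfl
  have h' : rowCochain (δ 0 1 s) j (j + 1) 0 (by omega) =
      Cochain.ofHom (rowMap (etaConeδ f) j ≫ (translationRowIso U j).hom ≫ rowMap f (j + 1)) := by
    refine Cochain.ext₀ _ _ (fun p => ?_)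
    rw [mappingCone.δ_snd, rowCochain_v, Cochain.ofHom_v, Cochain.neg_v, Gr.neg_app,
      Cochain.comp_zero_cochain_v, Cochain.ofHom_v, add_sub_cancel_left, mul_one]
    have e : ∀ x (hx : p + j + 1 = x),
        ((mappingCone.fst ((grTwist Λ).ηCplx.app U ≫ f)).1.v (p + j) x hx).app j j =
        ((mappingCone.fst ((grTwist Λ).ηCplx.app U ≫ f)).1.v (p + j) (p + j + 1) rfl).app j j ≫
          castX U (j + 1) hx := by
      rintro _ rfl
      exact (Category.comp_id _).symm
    rw [Gr.comp_app_succ _ _ j (j + 1) rfl, eta_comp_f_app_self f _ (j + 1), comp_zero, add_zero,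
      eta_comp_f_app, e]
    have e'' : ∀ (x : ((etaCone f).X (p + j)).obj j ⟶ (U.X (p + j + 1)).obj (j + 1)),
        (p + j).negOnePow • -((x ≫ castX U (j + 1) (show p + j + 1 = p + (j + 1) by ring)) ≫
          (f.f (p + (j + 1))).app (j + 1) (j + 1)) =
        (-x) ≫ ((p + j).negOnePow • castX U (j + 1) (show p + j + 1 = p + (j + 1) by ring)) ≫
          (f.f (p + (j + 1))).app (j + 1) (j + 1) := fun x => by
      rw [Linear.units_smul_comp, Linear.comp_units_smul, Preadditive.neg_comp, Category.assoc]
    refine (e'' _).trans ?_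
    exact congrArg (fun x : ((etaCone f).X (p + j)).obj j ⟶ (U.X (p + j + 1)).obj (j + 1) =>
        x ≫ ((p + j).negOnePow • castX U (j + 1) (show p + j + 1 = p + (j + 1) by ring)) ≫
          (f.f (p + (j + 1))).app (j + 1) (j + 1)) (etaConeδ_app f (p + j) j j).symm
  rw [h', hs, hs, rowCochain_diff _ _ rfl, rowCochain_diff _ _ rfl, ← Cochain.ofHom_comp,
    ← Cochain.ofHom_comp] at h
  refine ⟨Homotopy.equivSubZero.symm ((Cochain.equivHomotopy _ _).symm
    ⟨-rowCochain s j (j + 1) (-1) (by omega), ?_⟩)⟩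
  rw [Cochain.ofHom_zero, add_zero, Cochain.ofHom_sub, Cochain.ofHom_sub, h, δ_neg,
    Int.negOnePow_zero, Int.negOnePow_one, one_smul, Units.neg_smul, one_smul]
  abel

end Cone

end Translation

/-! ### Vanishing of maps between sums of shifted copies of a tilting complex -/

section Orthogonality

variable {A : Type u} [Category.{v} A] [Preadditive A]

/-- Cocycles modulo coboundaries are the morphisms to a shift in the homotopy category. -/
lemma isAcyclicHom_iff (F G : CochainComplex A ℤ) (r : ℤ) :
    IsAcyclicHom F G r ↔ ∀ f : (HomotopyCategory.quotient A _).obj F ⟶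
      (CategoryTheory.shiftFunctor (HomotopyCategory A (ComplexShape.up ℤ)) r).obj
        ((HomotopyCategory.quotient A _).obj G), f = 0 := by
  let e := ((HomotopyCategory.quotient A (ComplexShape.up ℤ)).commShiftIso r).app G
  constructor
  · intro h f
    obtain ⟨c, hc⟩ := (CohomologyClass.toHom_bijective F G r).2 (f ≫ e.inv)
    obtain ⟨z, rfl⟩ := c.mk_surjective
    have h0 : z ∈ coboundaries F G r := by
      obtain ⟨w, hw⟩ := h z.1 (z.δ_eq_zero _)
      exact ⟨r - 1, by omega, w, hw⟩
    rw [(CohomologyClass.toHom_mk_eq_zero_iff z).2 h0] at hc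
    rw [← cancel_mono e.inv, zero_comp, hc]
  · intro h z hz
    have h0 : Cocycle.mk z _ rfl hz ∈ coboundaries F G r := by
      rw [← CohomologyClass.toHom_mk_eq_zero_iff, ← cancel_mono e.hom, zero_comp]
      exact h _
    obtain ⟨m, hm, w, hw⟩ := h0
    obtain rfl : m = r - 1 := by omega
    exact ⟨w, hw⟩

end Orthogonality

section Sums

variable {Λ : Type u} [Ring Λ]

/-- The linear map underlying a morphism of projective modules. -/
abbrev ProjMod.lin {M N : ProjMod Λ} (f : M ⟶ N) : M.obj →ₗ[Λ] N.obj := f.hom.hom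

/-- A linear map between projective modules, as a morphism. -/
abbrev ProjMod.ofLin {M N : ProjMod Λ} (f : M.obj →ₗ[Λ] N.obj) : M ⟶ N :=
  ObjectProperty.homMk (ModuleCat.ofHom f)

lemma ProjMod.hom_ext {M N : ProjMod Λ} {f g : M ⟶ N}
    (h : ∀ x, ProjMod.lin f x = ProjMod.lin g x) : f = g :=
  ObjectProperty.hom_ext _ (ModuleCat.hom_ext (LinearMap.ext h))

lemma ProjMod.lin_sum {M N : ProjMod Λ} {κ : Type*} (S : Finset κ) (f : κ → (M ⟶ N)) (x : M.obj) :
    ProjMod.lin (∑ k ∈ S, f k) x = ∑ k ∈ S, ProjMod.lin (f k) x :=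
  map_sum (⟨⟨fun f => ProjMod.lin f x, rfl⟩, fun _ _ => rfl⟩ : (M ⟶ N) →+ N.obj) f S

/-- The direct sum of copies of `M` indexed by `κ`, as the module of finitely supported functions. -/
def finsuppModule (κ : Type u) (M : ProjMod Λ) : ProjMod Λ :=
  ⟨ModuleCat.of Λ (κ →₀ M.obj), by
    classical
    have : Module.Projective Λ M.obj := M.property
    exact Module.Projective.of_equiv (finsuppLEquivDirectSum Λ M.obj κ).symm⟩

/-- The inclusion of the summand `k`. -/
def finsuppModuleInj (κ : Type u) (M : ProjMod Λ) (k : κ) : M ⟶ finsuppModule κ M :=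
  ProjMod.ofLin (N := finsuppModule κ M) (Finsupp.lsingle k)

/-- The projection to the summand `k`. -/
def finsuppModuleProj (κ : Type u) (M : ProjMod Λ) (k : κ) : finsuppModule κ M ⟶ M :=
  ProjMod.ofLin (M := finsuppModule κ M) (Finsupp.lapply k)

/-- The map from a direct sum with given components. -/
def finsuppModuleDesc {κ : Type u} {M N : ProjMod Λ} (g : κ → (M ⟶ N)) : finsuppModule κ M ⟶ N :=
  ProjMod.ofLin (M := finsuppModule κ M) (Finsupp.lsum ℕ (fun k => ProjMod.lin (g k)))

lemma finsuppModuleInj_desc {κ : Type u} {M N : ProjMod Λ} (g : κ → (M ⟶ N)) (k : κ) :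
    finsuppModuleInj κ M k ≫ finsuppModuleDesc g = g k := by
  refine ProjMod.hom_ext (fun x => ?_)
  change Finsupp.lsum ℕ (fun k => ProjMod.lin (g k)) (Finsupp.single k x) = _
  rw [Finsupp.lsum_single]

lemma finsuppModuleInj_desc_assoc {κ : Type u} {M N P : ProjMod Λ} (g : κ → (M ⟶ N)) (k : κ)
    (h : N ⟶ P) : finsuppModuleInj κ M k ≫ finsuppModuleDesc g ≫ h = g k ≫ h := by
  rw [← Category.assoc, finsuppModuleInj_desc]

lemma finsuppModule_hom_ext {κ : Type u} {M N : ProjMod Λ} {f g : finsuppModule κ M ⟶ N}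
    (h : ∀ k, finsuppModuleInj κ M k ≫ f = finsuppModuleInj κ M k ≫ g) : f = g := by
  refine ObjectProperty.hom_ext _ (ModuleCat.hom_ext ?_)
  refine Finsupp.lhom_ext' (M := M.obj) (fun k => ?_)
  exact congrArg (fun f => ProjMod.lin f) (h k)

lemma finsuppModuleInj_proj_self (κ : Type u) (M : ProjMod Λ) (k : κ) :
    finsuppModuleInj κ M k ≫ finsuppModuleProj κ M k = 𝟙 M := by
  refine ProjMod.hom_ext (fun x => ?_)
  exact Finsupp.single_eq_same

lemma finsuppModuleInj_proj_ne (κ : Type u) (M : ProjMod Λ) {k l : κ} (h : k ≠ l) :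
    finsuppModuleInj κ M k ≫ finsuppModuleProj κ M l = 0 := by
  refine ProjMod.hom_ext (fun x => ?_)
  exact Finsupp.single_eq_of_ne h.symm

lemma finsuppModuleDesc_proj {κ : Type u} {M N : ProjMod Λ} (f : M ⟶ N) (k : κ) :
    finsuppModuleDesc (fun k => f ≫ finsuppModuleInj κ N k) ≫ finsuppModuleProj κ N k =
      finsuppModuleProj κ M k ≫ f := finsuppModule_hom_ext (fun l => by
  rw [finsuppModuleInj_desc_assoc, ← Category.assoc, Category.assoc f]
  by_cases h : l = k
  · subst h
    rw [finsuppModuleInj_proj_self, finsuppModuleInj_proj_self, Category.id_comp,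
      Category.comp_id]
  · rw [finsuppModuleInj_proj_ne _ _ h, finsuppModuleInj_proj_ne _ _ h, zero_comp, comp_zero])

/-- Compatible families of maps define a map of complexes on the direct sum. -/
lemma finsuppModuleDesc_comp_desc {κ : Type u} {M N P Q : ProjMod Λ} (f : M ⟶ N)
    (g : κ → (M ⟶ P)) (g' : κ → (N ⟶ Q)) (h : P ⟶ Q) (hg : ∀ k, g k ≫ h = f ≫ g' k) :
    finsuppModuleDesc g ≫ h =
      finsuppModuleDesc (fun k => f ≫ finsuppModuleInj κ N k) ≫ finsuppModuleDesc g' :=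
  finsuppModule_hom_ext (fun k => by
    rw [finsuppModuleInj_desc_assoc, finsuppModuleInj_desc_assoc, Category.assoc,
      finsuppModuleInj_desc, hg])

/-- A map from a finitely generated module to a direct sum has only finitely many nonzero
components. -/
lemma exists_finset_comp_proj (κ : Type u) {M N : ProjMod Λ} (hM : Module.Finite Λ M.obj)
    (f : M ⟶ finsuppModule κ N) : ∃ S : Finset κ, ∀ S', S ⊆ S' →
      f = ∑ k ∈ S', f ≫ finsuppModuleProj κ N k ≫ finsuppModuleInj κ N k := by
  classical
  let φ : M.obj →ₗ[Λ] (κ →₀ N.obj) := ProjMod.lin f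
  obtain ⟨s, hs⟩ := hM.fg_top
  have hφ : ∀ x, φ x ∈ Finsupp.supported N.obj Λ (s.biUnion (fun y => (φ y).support) : Set κ) := by
    have : (⊤ : Submodule Λ M.obj) ≤ (Finsupp.supported (N.obj : Type u) Λ
        ((s.biUnion (fun y => (φ y).support) : Finset κ) : Set κ)).comap φ := by
      rw [← hs, Submodule.span_le]
      intro y hy
      refine (Finsupp.mem_supported (M := N.obj) Λ _).2 ?_
      exact_mod_cast Finset.subset_biUnion_of_mem (fun y => (φ y).support) hy
    intro x
    simpa using this (Submodule.mem_top (x := x))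
  refine ⟨s.biUnion (fun y => (φ y).support), fun S' hS' => ProjMod.hom_ext (fun x => ?_)⟩
  rw [ProjMod.lin_sum]
  change φ x = ∑ k ∈ S', Finsupp.single k (φ x k)
  refine (Finsupp.sum_single (φ x)).symm.trans ?_
  refine Finset.sum_subset (fun k hk => hS' ?_) (fun k _ hk => ?_)
  · have := (Finsupp.mem_supported (M := N.obj) Λ _).1 (hφ x) hk
    simpa using this
  · rw [Finsupp.notMem_support_iff.1 hk, Finsupp.single_zero]

/-- The direct sum of copies of `T` indexed by `κ`. -/
def finsuppComplex (κ : Type u) (T : CochainComplex (ProjMod Λ) ℤ) :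
    CochainComplex (ProjMod Λ) ℤ where
  X p := finsuppModule κ (T.X p)
  d p q := finsuppModuleDesc (fun k => T.d p q ≫ finsuppModuleInj κ (T.X q) k)
  shape p q h := finsuppModule_hom_ext (fun k => by
    rw [finsuppModuleInj_desc, T.shape _ _ h, zero_comp, comp_zero])
  d_comp_d' p q r _ _ := finsuppModule_hom_ext (fun k => by
    rw [finsuppModuleInj_desc_assoc, Category.assoc, finsuppModuleInj_desc, T.d_comp_d_assoc,
      zero_comp, comp_zero])

/-- The inclusion of the summand `k`. -/
def finsuppInj (κ : Type u) (T : CochainComplex (ProjMod Λ) ℤ) (k : κ) :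
    T ⟶ finsuppComplex κ T where
  f p := finsuppModuleInj κ (T.X p) k
  comm' _ _ _ := finsuppModuleInj_desc _ _

/-- The projection to the summand `k`. -/
def finsuppProj (κ : Type u) (T : CochainComplex (ProjMod Λ) ℤ) (k : κ) :
    finsuppComplex κ T ⟶ T where
  f p := finsuppModuleProj κ (T.X p) k
  comm' p q _ := (finsuppModuleDesc_proj (T.d p q) k).symm

/-- The chain map from a direct sum of copies of `T` with given components. -/
def finsuppDesc (κ : Type u) (T Y : CochainComplex (ProjMod Λ) ℤ) (g : κ → (T ⟶ Y)) :
    finsuppComplex κ T ⟶ Y where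
  f p := finsuppModuleDesc (fun k => (g k).f p)
  comm' p q _ := finsuppModuleDesc_comp_desc _ _ _ _ (fun k => (g k).comm p q)

lemma finsuppInj_desc (κ : Type u) (T Y : CochainComplex (ProjMod Λ) ℤ) (g : κ → (T ⟶ Y)) (k : κ) :
    finsuppInj κ T k ≫ finsuppDesc κ T Y g = g k :=
  HomologicalComplex.hom_ext _ _ (fun p =>
    finsuppModuleInj_desc (fun k => (g k).f p) k)

lemma cochain_sum_v {C : Type*} [Category C] [Preadditive C] {F G : CochainComplex C ℤ} {n : ℤ}
    {κ : Type*} (S : Finset κ) (z : κ → Cochain F G n) (p q : ℤ) (hpq : p + n = q) :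
    (∑ k ∈ S, z k).v p q hpq = ∑ k ∈ S, (z k).v p q hpq :=
  map_sum (⟨⟨fun z => z.v p q hpq, rfl⟩, fun _ _ => rfl⟩ : Cochain F G n →+ (F.X p ⟶ G.X q)) z S

/-- A cochain from a bounded complex of finitely generated modules to a direct sum has only
finitely many nonzero components. -/
lemma exists_finset_cochain_eq_sum (κ : Type u) {T D : CochainComplex (ProjMod Λ) ℤ}
    (hT : IsBoundedFG T) {r : ℤ} (z : Cochain T (finsuppComplex κ D) r) :
    ∃ S : Finset κ, z = ∑ k ∈ S, (z.comp (Cochain.ofHom (finsuppProj κ D k)) (add_zero r)).comp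
      (Cochain.ofHom (finsuppInj κ D k)) (add_zero r) := by
  classical
  obtain ⟨⟨a, b, hab⟩, hfin⟩ := hT
  choose S hS using fun p => exists_finset_comp_proj κ (hfin p) (z.v p (p + r) rfl)
  refine ⟨(Finset.Icc a b).biUnion S, Cochain.ext _ _ (fun p q hpq => ?_)⟩
  obtain rfl := hpq
  rw [cochain_sum_v]
  by_cases hp : p ∈ Finset.Icc a b
  · refine (hS p _ (Finset.subset_biUnion_of_mem S hp)).trans
      (Finset.sum_congr rfl (fun k _ => ?_))
    rw [Cochain.comp_zero_cochain_v, Cochain.comp_zero_cochain_v, Category.assoc]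
    rfl
  · exact (hab p (by simp only [Finset.mem_Icc] at hp; omega)).eq_of_src _ _

/-- Maps from a tilting complex to a shifted direct sum of its copies vanish. -/
lemma isAcyclicHom_finsuppComplex {T : CochainComplex (ProjMod Λ) ℤ} (hT : IsTiltingComplex T)
    (κ : Type u) (r : ℤ) (hr : r ≠ 0) : IsAcyclicHom T (finsuppComplex κ T) r := by
  intro z hz
  obtain ⟨S, hS⟩ := exists_finset_cochain_eq_sum κ hT.isBoundedFG z
  have h : ∀ k, ∃ w : Cochain T T (r - 1),
      δ (r - 1) r w = z.comp (Cochain.ofHom (finsuppProj κ T k)) (add_zero r) := fun k =>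
    (isAcyclicHom_iff T T r).2 (hT.hom_shift_eq_zero r hr) _ (by rw [δ_comp_ofHom, hz]; simp)
  choose w hw using h
  refine ⟨∑ k ∈ S, (w k).comp (Cochain.ofHom (finsuppInj κ T k)) (add_zero _), ?_⟩
  rw [hS, ← δ_hom_apply ℤ, map_sum]
  refine Finset.sum_congr rfl (fun k _ => ?_)
  rw [δ_hom_apply, δ_comp_ofHom, hw]

/-- Each direct sum of copies of `T` in `K(Proj Λ)` is a retract of a direct sum of complexes. -/
lemma exists_retract_finsuppComplex {T : CochainComplex (ProjMod Λ) ℤ} {Y : KProj Λ}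
    (hY : isSum T Y) : ∃ (κ : Type u) (i : Y ⟶ (toKProj Λ).obj (finsuppComplex κ T))
      (p : (toKProj Λ).obj (finsuppComplex κ T) ⟶ Y), i ≫ p = 𝟙 Y := by
  obtain ⟨κ, j, ⟨hj⟩⟩ := hY
  choose g hg using fun k => (toKProj Λ).map_surjective (X := T) (Y := Y.as) (j k)
  refine ⟨κ, Cofan.IsColimit.desc hj (fun k => (toKProj Λ).map (finsuppInj κ T k)),
    (toKProj Λ).map (finsuppDesc κ T Y.as g), Cofan.IsColimit.hom_ext hj _ _ (fun k => ?_)⟩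
  refine (Category.assoc _ _ _).symm.trans ?_
  refine (congrArg (fun f => f ≫ (toKProj Λ).map (finsuppDesc κ T Y.as g))
    (Cofan.IsColimit.fac hj (fun k => (toKProj Λ).map (finsuppInj κ T k)) k)).trans ?_
  refine ((toKProj Λ).map_comp _ _).symm.trans ?_
  rw [finsuppInj_desc, hg]
  exact (Category.comp_id (j k)).symm

/-- Maps between an object of `Sum T` and a nonzero shift of another one vanish. -/
lemma hom_shift_eq_zero_of_isSum {T : CochainComplex (ProjMod Λ) ℤ} (hT : IsTiltingComplex T)
    {X Y : KProj Λ} (hX : isSum T X) (hY : isSum T Y) (r : ℤ) (hr : r ≠ 0)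
    (f : X ⟶ (CategoryTheory.shiftFunctor (KProj Λ) r).obj Y) : f = 0 := by
  obtain ⟨ι, j, ⟨hj⟩⟩ := hX
  obtain ⟨κ, i, p, hip⟩ := exists_retract_finsuppComplex hY
  refine Cofan.IsColimit.hom_ext hj _ _ (fun k => ?_)
  have h : (Cofan.mk X j).inj k ≫ f ≫ (CategoryTheory.shiftFunctor (KProj Λ) r).map i = 0 :=
    (isAcyclicHom_iff _ _ r).1 (isAcyclicHom_finsuppComplex hT κ r hr) _
  calc _ = ((Cofan.mk X j).inj k ≫ f ≫ (CategoryTheory.shiftFunctor (KProj Λ) r).map i) ≫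
      (CategoryTheory.shiftFunctor (KProj Λ) r).map p := by
        rw [Category.assoc, Category.assoc, ← Functor.map_comp, hip, CategoryTheory.Functor.map_id,
          Category.comp_id]
    _ = _ := by rw [h, zero_comp, comp_zero]

/-- The cocycles of nonzero degree between objects of `Sum T` are coboundaries. -/
lemma isAcyclicHom_of_isSum {T : CochainComplex (ProjMod Λ) ℤ} (hT : IsTiltingComplex T)
    {F G : CochainComplex (ProjMod Λ) ℤ} {X Y : KProj Λ} (hX : isSum T X) (hY : isSum T Y)
    (e : (toKProj Λ).obj F ≅ X) (e' : (toKProj Λ).obj G ≅ Y) (r : ℤ) (hr : r ≠ 0) :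
    IsAcyclicHom F G r := by
  rw [isAcyclicHom_iff]
  intro f
  rw [← cancel_epi e.inv, ← cancel_mono ((CategoryTheory.shiftFunctor (KProj Λ) r).map e'.hom)]
  rw [comp_zero, zero_comp]
  exact hom_shift_eq_zero_of_isSum hT hX hY r hr _

end Sums

/-! ### Realizations of complexes over `Sum T` -/

section Realizations

variable {Λ : Type u} [Ring Λ] {T : CochainComplex (ProjMod Λ) ℤ}

/-- A realization of a complex `X` over `Sum T` by a complex `U` over `gr Proj Λ`: isomorphisms in
`K(Proj Λ)` from the rows of `U` to the components of `X`, under which the classes of `(-1)^i d_1`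
correspond to the differential of `X`. -/
structure Realization (X : CochainComplex (SumCat T) ℤ) (U : CochainComplex (Gr (ProjMod Λ)) ℤ) where
  iso : ∀ j, (toKProj Λ).obj (grRow U j) ≅ (X.X j).obj
  comm : ∀ j k (h : j + 1 = k),
    (iso j).hom ≫ (X.d j k).hom = (toKProj Λ).map (rowD U j k h) ≫ (iso k).hom

/-- A chain map `f` between realizations of `X` and `Y` lifts `α` if its components `f_0`
correspond to the components of `α`. -/
def IsLift {X Y : CochainComplex (SumCat T) ℤ} {U V : CochainComplex (Gr (ProjMod Λ)) ℤ}
    (e : Realization X U) (e' : Realization Y V) (α : X ⟶ Y) (f : U ⟶ V) : Prop :=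
  ∀ j, (toKProj Λ).map (rowMap f j) ≫ (e'.iso j).hom = (e.iso j).hom ≫ (α.f j).hom

variable {X Y Z : CochainComplex (SumCat T) ℤ} {U V W : CochainComplex (Gr (ProjMod Λ)) ℤ}
  (e : Realization X U) (e' : Realization Y V) {e'' : Realization Z W}

/-- The rows of realizations are in `Sum T` up to isomorphism, so that the vanishing of maps to
shifts applies. -/
lemma Realization.orthogonalRows (hT : IsTiltingComplex T) (e : Realization X U)
    (e' : Realization Y V) : OrthogonalRows U V :=
  fun j k r hr => isAcyclicHom_of_isSum hT (X.X j).property (Y.X k).property (e.iso j) (e'.iso k)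
    r hr

/-- Morphisms of `C(Sum T)` lift to realizations, for any choice of representatives of the
components. -/
lemma exists_rowMap_eq_of_realization (hT : IsTiltingComplex T) (α : X ⟶ Y)
    (a : ∀ j, grRow U j ⟶ grRow V j)
    (ha : ∀ j, (toKProj Λ).map (a j) ≫ (e'.iso j).hom = (e.iso j).hom ≫ (α.f j).hom) :
    ∃ f : U ⟶ V, ∀ j, rowMap f j = a j := by
  refine exists_rowMap_eq (Realization.orthogonalRows hT e e') a (fun j k h => ?_)
  refine ⟨HomotopyCategory.homotopyOfEq _ _ ?_⟩
  refine ((toKProj Λ).map_comp _ _).trans (Eq.trans ?_ ((toKProj Λ).map_comp _ _).symm)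
  rw [← cancel_mono (e'.iso k).hom, Category.assoc, Category.assoc, ← e'.comm, ← Category.assoc,
    ha, ha, ← Category.assoc, ← e.comm, Category.assoc, Category.assoc,
    ← ObjectProperty.FullSubcategory.comp_hom, ← ObjectProperty.FullSubcategory.comp_hom, α.comm]

lemma exists_isLift (hT : IsTiltingComplex T) (α : X ⟶ Y) : ∃ f : U ⟶ V, IsLift e e' α f := by
  choose a ha using fun j => (toKProj Λ).map_surjective
    ((e.iso j).hom ≫ (α.f j).hom ≫ (e'.iso j).inv)
  obtain ⟨f, hf⟩ := exists_rowMap_eq_of_realization e e' hT α a (fun j => by simp [ha])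
  exact ⟨f, fun j => by rw [hf, ha]; simp⟩

variable {e e'}

/-- Lifts of the same chain map are homotopic, not only `η`-homotopic. -/
lemma IsLift.nonempty_homotopy (hT : IsTiltingComplex T) {α : X ⟶ Y} {f g : U ⟶ V}
    (hf : IsLift e e' α f) (hg : IsLift e e' α g) : Nonempty (Homotopy f g) :=
  nonempty_homotopy_of_rows (Realization.orthogonalRows hT e e') f g (fun j =>
    ⟨HomotopyCategory.homotopyOfEq _ _ (by
      have h := (hf j).trans (hg j).symm
      rwa [cancel_mono] at h)⟩)

variable (e) in
lemma IsLift.id : IsLift e e (𝟙 X) (𝟙 U) := fun j => by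
  rw [rowMap_id]
  exact (congrArg (· ≫ (e.iso j).hom) ((toKProj Λ).map_id (grRow U j))).trans
    ((Category.id_comp _).trans (Category.comp_id _).symm)

lemma IsLift.comp {α : X ⟶ Y} {β : Y ⟶ Z} {f : U ⟶ V} {g : V ⟶ W}
    (hf : IsLift e e' α f) (hg : IsLift e' e'' β g) : IsLift e e'' (α ≫ β) (f ≫ g) := fun j => by
  rw [rowMap_comp, HomologicalComplex.comp_f, ObjectProperty.FullSubcategory.comp_hom,
    Functor.map_comp, Category.assoc, hg, ← Category.assoc, hf, Category.assoc]

lemma IsLift.add {α β : X ⟶ Y} {f g : U ⟶ V} (hf : IsLift e e' α f) (hg : IsLift e e' β g) :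
    IsLift e e' (α + β) (f + g) := fun j => by
  rw [rowMap_add, Functor.map_add, Preadditive.add_comp, hf, hg]
  exact (Preadditive.comp_add _ _ _ _ _ _).symm

lemma IsLift.sub {α β : X ⟶ Y} {f g : U ⟶ V} (hf : IsLift e e' α f) (hg : IsLift e e' β g) :
    IsLift e e' (α - β) (f - g) := fun j => by
  rw [rowMap_sub, Functor.map_sub, Preadditive.sub_comp, hf, hg]
  exact (Preadditive.comp_sub _ _ _).symm

/-- The isomorphism from the `j`-th row of `U(1)[1]` to `X^(j+1)`. -/
def Realization.translationIso (e : Realization X U) (j : ℤ) :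
    (toKProj Λ).obj (grRow ((grTwist Λ).translationCplx.obj U) j) ≅ (X.X (j + 1)).obj :=
  (toKProj Λ).mapIso (translationRowIso U j) ≪≫ e.iso (j + 1)

lemma Realization.translationIso_hom (e : Realization X U) (j : ℤ) :
    (e.translationIso j).hom =
      (toKProj Λ).map (translationRowIso U j).hom ≫ (e.iso (j + 1)).hom := rfl

lemma Realization.translationIso_comm (e : Realization X U) (j k : ℤ) (h : j + 1 = k) :
    (e.translationIso j).hom ≫ (X.d (j + 1) (k + 1)).hom =
      -((toKProj Λ).map (rowD ((grTwist Λ).translationCplx.obj U) j k h) ≫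
        (e.translationIso k).hom) := by
  rw [translationIso_hom, translationIso_hom, ← Category.assoc ((toKProj Λ).map (rowD _ _ _ _)),
    ← Functor.map_comp, rowD_translation_comp, Functor.map_neg, Functor.map_comp,
    Preadditive.neg_comp, Category.assoc, Category.assoc, neg_neg,
    e.comm _ _ (show j + 1 + 1 = k + 1 by omega)]

/-- The realization of `X[1]` by `U(1)[1]`. -/
def Realization.translation (e : Realization X U) :
    Realization ((CategoryTheory.shiftFunctor _ (1 : ℤ)).obj X)
      ((grTwist Λ).translationCplx.obj U) where
  iso j := e.translationIso j
  comm j k h := by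
    refine Eq.trans (b := (e.translationIso j).hom ≫ (-(X.d (j + 1) (k + 1)).hom))
      (congrArg (fun x : X.X (j + 1) ⟶ X.X (k + 1) => (e.translationIso j).hom ≫ x.hom) ?_) ?_
    · change (Int.negOnePow 1) • X.d (j + 1) (k + 1) = -(X.d (j + 1) (k + 1))
      rw [Int.negOnePow_one, Units.neg_smul, one_smul]
    · rw [Preadditive.comp_neg, e.translationIso_comm j k h, neg_neg]
      rfl

lemma IsLift.translation {α : X ⟶ Y} {f : U ⟶ V} (hf : IsLift e e' α f) :
    IsLift e.translation e'.translation ((CategoryTheory.shiftFunctor _ (1 : ℤ)).map α)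
      ((grTwist Λ).translationCplx.map f) := fun j => by
  change (toKProj Λ).map _ ≫ (toKProj Λ).map (translationRowIso V j).hom ≫ (e'.iso (j + 1)).hom =
    ((toKProj Λ).map (translationRowIso U j).hom ≫ (e.iso (j + 1)).hom) ≫ (α.f (j + 1)).hom
  rw [← Category.assoc, ← Functor.map_comp, rowMap_translation_comp, Functor.map_comp,
    Category.assoc, hf, Category.assoc]

section Cone

variable {α : X ⟶ Y} {f : U ⟶ V}

/-- The inclusion `X^(j+1) ⟶ cone(α)^j` as a morphism of `K(Proj Λ)`. -/
def coneInl (α : X ⟶ Y) (j : ℤ) : (X.X (j + 1)).obj ⟶ ((mappingCone α).X j).obj :=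
  ((mappingCone.inl α).v (j + 1) j (by omega)).hom

/-- The inclusion `Y^j ⟶ cone(α)^j` as a morphism of `K(Proj Λ)`. -/
def coneInr (α : X ⟶ Y) (j : ℤ) : (Y.X j).obj ⟶ ((mappingCone α).X j).obj :=
  ((mappingCone.inr α).f j).hom

/-- The projection `cone(α)^j ⟶ X^(j+1)` as a morphism of `K(Proj Λ)`. -/
def coneFst (α : X ⟶ Y) (j : ℤ) : ((mappingCone α).X j).obj ⟶ (X.X (j + 1)).obj :=
  ((mappingCone.fst α).1.v j (j + 1) rfl).hom

/-- The projection `cone(α)^j ⟶ Y^j` as a morphism of `K(Proj Λ)`. -/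
def coneSnd (α : X ⟶ Y) (j : ℤ) : ((mappingCone α).X j).obj ⟶ (Y.X j).obj :=
  ((mappingCone.snd α).v j j (add_zero j)).hom

lemma coneInl_d (α : X ⟶ Y) (j : ℤ) :
    coneInl α j ≫ ((mappingCone α).d j (j + 1)).hom =
      (α.f (j + 1)).hom ≫ coneInr α (j + 1) -
        (X.d (j + 1) (j + 1 + 1)).hom ≫ coneInl α (j + 1) :=
  congrArg (fun x => x.hom)
    (mappingCone.inl_v_d α (j + 1) j (j + 1 + 1) (by omega) (by omega))

lemma coneInr_d (α : X ⟶ Y) (j k : ℤ) :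
    coneInr α j ≫ ((mappingCone α).d j k).hom = (Y.d j k).hom ≫ coneInr α k :=
  congrArg (fun x => x.hom) ((mappingCone.inr α).comm j k)

/-- The isomorphism between two biproducts with isomorphic summands, up to the sign of the first
summand. -/
def isoOfBiproducts {C : Type*} [Category C] [Preadditive C] {R S L M N D : C}
    {δ : R ⟶ S} {i : S ⟶ R} {s : R ⟶ L} {r : L ⟶ R} {inl : M ⟶ D} {fst : D ⟶ M} {inr : N ⟶ D}
    {snd : D ⟶ N} (a : S ≅ M) (b : L ≅ N)
    (h₁ : i ≫ δ = -𝟙 _) (h₂ : i ≫ s = 0) (h₃ : r ≫ δ = 0) (h₄ : r ≫ s = 𝟙 _)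
    (h : -(δ ≫ i) + s ≫ r = 𝟙 _) (h₁' : inl ≫ fst = 𝟙 _) (h₂' : inl ≫ snd = 0)
    (h₃' : inr ≫ fst = 0) (h₄' : inr ≫ snd = 𝟙 _) (h' : fst ≫ inl + snd ≫ inr = 𝟙 _) : R ≅ D where
  hom := -(δ ≫ a.hom ≫ inl) + s ≫ b.hom ≫ inr
  inv := fst ≫ a.inv ≫ i + snd ≫ b.inv ≫ r
  hom_inv_id := by
    simp only [Preadditive.add_comp, Preadditive.comp_add, Preadditive.neg_comp, Category.assoc,
      reassoc_of% h₁', reassoc_of% h₂', reassoc_of% h₃', reassoc_of% h₄', zero_comp, comp_zero,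
      Iso.hom_inv_id_assoc, add_zero, zero_add, h, neg_zero]
  inv_hom_id := by
    simp only [Preadditive.add_comp, Preadditive.comp_add, Preadditive.comp_neg, Category.assoc,
      reassoc_of% h₁, reassoc_of% h₂, reassoc_of% h₃, reassoc_of% h₄, zero_comp, comp_zero,
      Iso.inv_hom_id_assoc, add_zero, zero_add, h', Preadditive.neg_comp, neg_neg,
      Category.id_comp]

/-- The isomorphism between the rows of `cone(f η_U)` and the components of `cone(α)`. The sign in
`isoOfBiproducts` comes from `etaConeδ`, which is minus the projection to the first summand. -/
def coneRowIso (e : Realization X U) (e' : Realization Y V) (α : X ⟶ Y) (f : U ⟶ V) (j : ℤ) :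
    (toKProj Λ).obj (grRow (etaCone f) j) ≅ ((mappingCone α).X j).obj :=
  isoOfBiproducts (δ := (toKProj Λ).map (rowMap (etaConeδ f) j))
    (i := (toKProj Λ).map (rowInl f j)) (s := (toKProj Λ).map (rowSnd f j))
    (r := (toKProj Λ).map (rowMap (etaConeInr f) j)) (inl := coneInl α j) (fst := coneFst α j)
    (inr := coneInr α j) (snd := coneSnd α j)
    (e.translationIso j) (e'.iso j)
    (by rw [← Functor.map_comp, rowInl_comp_δ, Functor.map_neg, CategoryTheory.Functor.map_id])
    (by rw [← Functor.map_comp, rowInl_comp_rowSnd, Functor.map_zero])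
    (by rw [← Functor.map_comp, inr_comp_rowMap_δ, Functor.map_zero])
    (by rw [← Functor.map_comp, inr_comp_rowSnd, CategoryTheory.Functor.map_id])
    (by rw [← Functor.map_comp, ← Functor.map_comp, ← Functor.map_neg, ← Functor.map_add,
      etaCone_row_total, CategoryTheory.Functor.map_id])
    (congrArg (fun x => x.hom) (mappingCone.inl_v_fst_v α (j + 1) j (by omega)))
    (congrArg (fun x => x.hom) (mappingCone.inl_v_snd_v α (j + 1) j (by omega)))
    (congrArg (fun x => x.hom) (mappingCone.inr_f_fst_v α j (j + 1) rfl))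
    (congrArg (fun x => x.hom) (mappingCone.inr_f_snd_v α j))
    (congrArg (fun x => x.hom) (mappingCone.id_X α j (j + 1) rfl))

lemma coneRowIso_hom (e : Realization X U) (e' : Realization Y V) (α : X ⟶ Y) (f : U ⟶ V) (j : ℤ) :
    (coneRowIso e e' α f j).hom =
      -((toKProj Λ).map (rowMap (etaConeδ f) j) ≫ (e.translationIso j).hom ≫ coneInl α j) +
        (toKProj Λ).map (rowSnd f j) ≫ (e'.iso j).hom ≫ coneInr α j := rfl

/-- The realization of `cone(α)` by `cone(f η_U)`, where `f` lifts `α`. -/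
def IsLift.cone (hf : IsLift e e' α f) : Realization (mappingCone α) (etaCone f) where
  iso j := coneRowIso e e' α f j
  comm j k h := by
    subst h
    have h₁ : (toKProj Λ).map (rowD (etaCone f) j (j + 1) rfl) ≫
          (toKProj Λ).map (rowMap (etaConeδ f) (j + 1)) =
        (toKProj Λ).map (rowMap (etaConeδ f) j) ≫
          (toKProj Λ).map (rowD ((grTwist Λ).translationCplx.obj U) j (j + 1) rfl) := by
      rw [← Functor.map_comp, ← Functor.map_comp]
      exact (HomotopyCategory.eq_of_homotopy _ _
        (nonempty_homotopy_map_comp_rowD (etaConeδ f) j (j + 1) rfl).some).symm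
    have h₂ : (toKProj Λ).map (rowD (etaCone f) j (j + 1) rfl) ≫
          (toKProj Λ).map (rowSnd f (j + 1)) =
        (toKProj Λ).map (rowSnd f j) ≫ (toKProj Λ).map (rowD V j (j + 1) rfl) -
          (toKProj Λ).map (rowMap (etaConeδ f) j) ≫
            (toKProj Λ).map (translationRowIso U j).hom ≫
              (toKProj Λ).map (rowMap f (j + 1)) := by
      rw [← Functor.map_comp, ← Functor.map_comp, ← Functor.map_comp, ← Functor.map_comp,
        ← Functor.map_sub]
      exact (HomotopyCategory.eq_of_homotopy _ _ (nonempty_homotopy_rowSnd f j).some).symm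
    have h₃ := e.translationIso_comm j (j + 1) rfl
    have h₄ : (e.translationIso j).hom ≫ (α.f (j + 1)).hom =
        (toKProj Λ).map (translationRowIso U j).hom ≫ (toKProj Λ).map (rowMap f (j + 1)) ≫
          (e'.iso (j + 1)).hom := by
      rw [e.translationIso_hom, hf, Category.assoc]
    rw [coneRowIso_hom, coneRowIso_hom]
    simp only [Preadditive.add_comp, Preadditive.neg_comp, Category.assoc, coneInl_d, coneInr_d,
      Preadditive.comp_add, Preadditive.comp_neg, Preadditive.comp_sub, reassoc_of% h₁,
      reassoc_of% h₂, reassoc_of% h₃, reassoc_of% h₄, Preadditive.sub_comp,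
      reassoc_of% (e'.comm j (j + 1) rfl)]
    abel

/-- The inclusion of `V` into the cone lifts the inclusion of `Y`. -/
lemma IsLift.inr_cone (hf : IsLift e e' α f) :
    IsLift e' hf.cone (mappingCone.inr α) (etaConeInr f) := fun j => by
  change _ ≫ (coneRowIso e e' α f j).hom = (e'.iso j).hom ≫ coneInr α j
  rw [coneRowIso_hom, Preadditive.comp_add, Preadditive.comp_neg, ← Category.assoc,
    ← Functor.map_comp, inr_comp_rowMap_δ, Functor.map_zero, zero_comp, neg_zero, zero_add,
    ← Category.assoc ((toKProj Λ).map _), ← Functor.map_comp, inr_comp_rowSnd,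
    CategoryTheory.Functor.map_id, Category.id_comp]

/-- The projection `cone(α)^j ⟶ X[1]^j` as a morphism of `K(Proj Λ)`. -/
def coneδ (α : X ⟶ Y) (j : ℤ) : ((mappingCone α).X j).obj ⟶ (X.X (j + 1)).obj :=
  ((mappingCone.triangle α).mor₃.f j).hom

/-- The projection `cone(f η_U) ⟶ U(1)[1]` lifts the projection `cone(α) ⟶ X[1]`. -/
lemma IsLift.cone_δ (hf : IsLift e e' α f) :
    IsLift hf.cone e.translation (mappingCone.triangle α).mor₃ (etaConeδ f) := fun j => by
  have h₁ : coneInl α j ≫ coneδ α j = -𝟙 _ :=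
    congrArg (fun x => x.hom) (mappingCone.inl_v_triangle_mor₃_f α (j + 1) j (by omega))
  have h₂ : coneInr α j ≫ coneδ α j = 0 :=
    congrArg (fun x => x.hom) (mappingCone.inr_f_triangle_mor₃_f α j)
  change _ ≫ (e.translationIso j).hom = (coneRowIso e e' α f j).hom ≫ coneδ α j
  rw [coneRowIso_hom, Preadditive.add_comp, Preadditive.neg_comp, Category.assoc, Category.assoc,
    Category.assoc, Category.assoc, h₂, comp_zero, comp_zero, add_zero, h₁, Preadditive.comp_neg,
    Preadditive.comp_neg, neg_neg, Category.comp_id]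

end Cone

/-- The realization `cone(η_U)` of `cone(𝟙 X)` is contractible up to `η`. -/
lemma nonempty_homotopy_eta_etaCone_id (U : CochainComplex (Gr (ProjMod Λ)) ℤ) :
    Nonempty (Homotopy ((grTwist Λ).ηCplx.app (etaCone (𝟙 U))) 0) := by
  have h : ∀ φ, φ = (grTwist Λ).ηCplx.app U →
      Nonempty (Homotopy ((grTwist Λ).ηCplx.app (mappingCone φ)) 0) := by
    rintro _ rfl
    exact (grTwist Λ).homotopy_cone U
  exact h _ (Category.comp_id _)

/-- Lifts of homotopic chain maps are `η`-homotopic: a null-homotopic chain map factors through the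
cone of an identity, which has a realization on which `η` is null-homotopic. -/
lemma IsLift.etaHomotopic (hT : IsTiltingComplex T) {α β : X ⟶ Y} {f g : U ⟶ V}
    (hf : IsLift e e' α f) (hg : IsLift e e' β g) (h : Homotopy α β) :
    (grTwist Λ).EtaHomotopic f g := by
  obtain ⟨z, hz⟩ := Twist.exists_cochain (Homotopy.equivSubZero h)
  obtain ⟨p, hp⟩ := exists_isLift (IsLift.id e).cone e' hT
    (mappingCone.desc (𝟙 X) z (α - β) (by rw [hz, Category.id_comp]))
  have h₁ := (IsLift.id e).inr_cone.comp hp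
  rw [mappingCone.inr_desc] at h₁
  obtain ⟨H⟩ := (hf.sub hg).nonempty_homotopy hT h₁
  obtain ⟨H'⟩ := nonempty_homotopy_eta_etaCone_id U
  have h₂ : (grTwist Λ).ηCplx.app U ≫ etaConeInr (𝟙 U) ≫ p =
      (grTwist Λ).onCplx.map (etaConeInr (𝟙 U)) ≫ (grTwist Λ).ηCplx.app _ ≫ p :=
    ((grTwist Λ).ηCplx.naturality_assoc (etaConeInr (𝟙 U)) p).symm
  have H₃ : Homotopy ((grTwist Λ).ηCplx.app U ≫ (f - g)) 0 :=
    (H.compLeft _).trans ((Homotopy.ofEq h₂).trans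
      (((H'.compRight p).compLeft _).trans (Homotopy.ofEq (by simp))))
  rw [Preadditive.comp_sub] at H₃
  exact ⟨Homotopy.equivSubZero.symm H₃⟩

end Realizations

/-! ### The Maurer-Cartan equation -/

section MaurerCartan

variable {A : Type u} [Category.{v} A] [Preadditive A] {U : CochainComplex (Gr A) ℤ}

/-- The curvature `d E + E d + E²` of a perturbation `E` of the differential of `U`: it vanishes if
and only if `d + E` is a differential. -/
def curvature (E : Cochain U U 1) : Cochain U U 2 := δ 1 2 E + E.comp E (by omega)

lemma curvature_sub (E w : Cochain U U 1) : curvature (E - w) = (curvature E - δ 1 2 w) -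
    (E.comp w (show 1 + 1 = 2 by omega) + w.comp E (show 1 + 1 = 2 by omega) -
      w.comp w (show 1 + 1 = 2 by omega)) := by
  simp only [curvature, δ_sub, Cochain.comp_sub, Cochain.sub_comp]
  abel

lemma filtGE_curvature_sub {E w : Cochain U U 1} {m : ℤ} (hE : FiltGE 1 E) (hw : FiltGE m w)
    (hm : 1 ≤ m) (h : FiltGE (m + 1) (curvature E - δ 1 2 w)) :
    FiltGE (m + 1) (curvature (E - w)) := by
  rw [curvature_sub]
  refine h.sub (((hE.comp hw _ (add_comm _ _)).add (hw.comp hE _ rfl)).sub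
    ((hw.comp hw _ rfl).mono (by omega)))

/-- The Bianchi identity. -/
lemma δ_curvature (E : Cochain U U 1) : δ 2 3 (curvature E) =
    E.comp (curvature E) (show 1 + 2 = 3 by omega) -
      (curvature E).comp E (show 2 + 1 = 3 by omega) := by
  rw [curvature, δ_add, δ_δ, zero_add, δ_comp E E _ 2 2 3 (by omega) (by omega) (by omega),
    Int.negOnePow_one, Units.neg_smul, one_smul, Cochain.comp_add, Cochain.add_comp,
    Cochain.comp_assoc E E E (show 1 + 1 = 2 by omega) (show 1 + 1 = 2 by omega) (by omega)]
  abel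

/-- Maps of rows with null-homotopic composites are the leading part of a perturbation of a
differential of order zero. -/
lemma exists_curvature_eq_zero (hU : ∀ p q j k, j ≠ k → (U.d p q).app j k = 0)
    (H : OrthogonalRows U U) (c : ∀ j k, j + 1 = k → (grRow U j ⟶ grRow U k))
    (hc : ∀ j k l (hk : j + 1 = k) (hl : k + 1 = l), Nonempty (Homotopy (c j k hk ≫ c k l hl) 0)) :
    ∃ E : Cochain U U 1, FiltGE 1 E ∧
      (∀ j k h, rowCochain E j k 0 (by omega) = Cochain.ofHom (c j k h)) ∧ curvature E = 0 := by
  obtain ⟨E₁, hE₁, hE₁c⟩ := exists_rowCochain_eq (U := U) (V := U) (n := 1) 1 0 rfl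
    (fun j k h => Cochain.ofHom (c j k h.symm)) (by omega)
  have h₁ : FiltGE 2 (curvature E₁) := by
    refine FiltGE.add (FiltGE.succ (m := 1) (hE₁.δ 2) (r := 1) rfl (fun j k hk => ?_))
      (hE₁.comp hE₁ _ rfl)
    rw [rowCochain_δ hE₁ 2 rfl j k 0 1 hk (by omega) rfl, hE₁c _ _ hk, δ_ofHom]
  -- the part of order two of the curvature is the coboundary of the part of order two of `E₁` minus
  -- the composites `c c`; the correction `w₁` makes it vanish
  choose ω hω using fun j k l hk hl => Twist.exists_cochain (hc j k l hk hl).some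
  obtain ⟨w₁, hw₁, hw₁ω⟩ := exists_rowCochain_eq (U := U) (V := U) (n := 1) 2 (-1) rfl
    (fun j l h => rowCochain E₁ j l (-1) (by omega) - ω j (j + 1) l rfl (by omega)) (by omega)
  have h₂ : FiltGE 3 (curvature E₁ - δ 1 2 w₁) := by
    refine FiltGE.succ (m := 2) (h₁.sub (hw₁.δ 2)) (r := 0) rfl (fun j l hl => ?_)
    rw [rowCochain_sub, rowCochain_δ hw₁ 2 rfl j l (-1) 0 hl (by omega) rfl, hw₁ω _ _ hl,
      curvature, rowCochain_add, rowCochain_δ_of_deg0 hU hU E₁ 2 rfl j l (-1) 0 (by omega) rfl,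
      rowCochain_comp hE₁ hE₁ _ j (j + 1) l 0 0 0 rfl (by omega) (by omega) (by omega) rfl,
      hE₁c _ _ rfl, hE₁c _ _ (by omega), δ_sub, hω, Cochain.ofHom_comp]
    simp
  -- by the Bianchi identity, the leading part of a curvature of order `3 + s` is a cocycle, of
  -- negative row degree `-1 - s`
  obtain ⟨E, hE⟩ := exists_limit (U := U) (V := U) (n := 1) 3
    (fun s E => (FiltGE 1 E ∧
      (∀ j k h, rowCochain E j k 0 (by omega) = Cochain.ofHom (c j k h))) ∧
      FiltGE (3 + s : ℤ) (curvature E)) (E₁ - w₁)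
    ⟨⟨hE₁.sub (hw₁.mono (by omega)), fun j k h => by
      rw [rowCochain_sub, hE₁c _ _ h.symm, hw₁.rowCochain_eq_zero _ _ _ _ (by omega), sub_zero]⟩,
      by simpa using filtGE_curvature_sub (m := 2) hE₁ hw₁ (by omega) h₂⟩ (by
      rintro s E ⟨⟨hE, hEc⟩, hs⟩
      obtain ⟨w, hw, hw'⟩ : ∃ w : Cochain U U 1, FiltGE (3 + s : ℤ) w ∧
          FiltGE (3 + s + 1 : ℤ) (curvature E - δ 1 2 w) :=
        exists_filtGE_succ (by omega) hs (r := -1 - s) (by ring) (by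
          rw [show (2 + 1 : ℤ) = 3 from rfl, δ_curvature]
          exact (hE.comp hs _ (add_comm _ _)).sub (hs.comp hE _ rfl))
        (fun j k _ => H j k _ (by omega))
      refine ⟨E - w, ⟨⟨hE.sub (hw.mono (by omega)), fun j k h => ?_⟩, ?_⟩, ?_⟩
      · rw [rowCochain_sub, hEc, hw.rowCochain_eq_zero _ _ _ _ (by omega), sub_zero]
      · refine (filtGE_curvature_sub hE hw (by omega) hw').mono (by push_cast; omega)
      · rw [sub_sub_cancel_left]
        exact hw.neg)
  obtain ⟨E', ⟨⟨hE', hE'c⟩, -⟩, hd⟩ := hE 0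
  refine ⟨E, ?_, fun j k h => ?_, eq_zero_of_filtGE (fun s => ?_)⟩
  · rw [← sub_add_cancel E E']
    exact (hd.mono (by omega)).add hE'
  · rw [← sub_add_cancel E E', rowCochain_add, hE'c, hd.rowCochain_eq_zero _ _ _ _ (by omega),
      zero_add]
  · obtain ⟨E', ⟨⟨hE', -⟩, hs⟩, hd⟩ := hE s
    rw [show E = E' - (E' - E) by abel]
    have hd' : FiltGE (3 + s : ℤ) (E' - E) := by
      rw [← neg_sub]
      exact hd.neg
    refine (filtGE_curvature_sub (m := 2 + s) hE' (hd'.mono (by omega)) (by omega)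
      ((hs.sub (hd'.δ 2)).mono (by omega))).mono (by omega)

end MaurerCartan

/-! ### Lifts of objects and morphisms -/

section Lifts

variable {Λ : Type u} [Ring Λ] {T : CochainComplex (ProjMod Λ) ℤ}

/-- The complex over `gr Proj Λ` with components `X^{i-j,j}` and the differential `δ_0`, which is
concentrated in order zero. -/
def thetaBase (X : CochainComplex (SumCat T) ℤ) : CochainComplex (Gr (ProjMod Λ)) ℤ where
  X := thetaObj X
  d i k := Gr.deg0 (X := thetaObj X i) (Y := thetaObj X k) (fun j => (row X j).d (i - j) (k - j))
  shape i k h := by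
    refine Eq.trans (congrArg _ (funext fun j => (row X j).shape _ _ (fun h' => h ?_))) Gr.deg0_zero
    rw [ComplexShape.up_Rel] at h' ⊢
    omega
  d_comp_d' i k l _ _ :=
    (Gr.deg0_comp (X := thetaObj X i) (Y := thetaObj X k) (Z := thetaObj X l) _ _).trans
      (Eq.trans (congrArg _ (funext fun j => (row X j).d_comp_d _ _ _)) Gr.deg0_zero)

lemma thetaBase_d_app_self (X : CochainComplex (SumCat T) ℤ) (i k j : ℤ) :
    ((thetaBase X).d i k).app j j = (row X j).d (i - j) (k - j) :=
  Gr.Hom.deg0_app_self (X := thetaObj X i) (Y := thetaObj X k) _ j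

lemma thetaBase_d_app_ne (X : CochainComplex (SumCat T) ℤ) (i k j l : ℤ) (h : j ≠ l) :
    ((thetaBase X).d i k).app j l = 0 :=
  Gr.Hom.deg0_app_ne (X := thetaObj X i) (Y := thetaObj X k) _ h

/-- The reindexing isomorphism from the `j`-th row of a complex with components `X^{i-j,j}` and with
leading part `δ_0` of the differential. -/
def thetaRowIso {X : CochainComplex (SumCat T) ℤ} {d : ∀ i k : ℤ, thetaObj X i ⟶ thetaObj X k}
    {hd : ∀ i k, ¬ (ComplexShape.up ℤ).Rel i k → d i k = 0}
    {hdd : ∀ i k l, (ComplexShape.up ℤ).Rel i k → (ComplexShape.up ℤ).Rel k l →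
      d i k ≫ d k l = 0}
    (hd₀ : ∀ i k j : ℤ, i + 1 = k → (d i k).app j j = (row X j).d (i - j) (k - j)) (j : ℤ) :
    grRow { X := thetaObj X, d := d, shape := hd, d_comp_d' := hdd } j ≅ row X j :=
  HomologicalComplex.Hom.isoOfComponents
    (fun p => (row X j).XIsoOfEq (show p + j - j = p by omega)) (fun p q hpq => by
      obtain rfl : p + 1 = q := hpq
      refine ((row X j).XIsoOfEq_hom_comp_d (show p + j - j = p by omega) (p + 1)).trans
        (Eq.trans ?_ (congrArg (· ≫ ((row X j).XIsoOfEq (show p + 1 + j - j = p + 1 by omega)).hom)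
          (hd₀ (p + j) (p + 1 + j) j (by omega)).symm))
      exact ((row X j).d_comp_XIsoOfEq_hom _ _).symm.trans rfl)

/-- The reindexing isomorphism from the `j`-th row of the complex with differential `δ_0`. -/
def thetaBaseRowIso (X : CochainComplex (SumCat T) ℤ) (j : ℤ) : grRow (thetaBase X) j ≅ row X j :=
  thetaRowIso (fun i k j _ => thetaBase_d_app_self X i k j) j

namespace ThetaLift

variable {X Y : CochainComplex (SumCat T) ℤ}

/-- The reindexing isomorphism from the `j`-th row of a lift. -/
def rowIso (L : ThetaLift X) (j : ℤ) : grRow L.cplx j ≅ row X j :=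
  thetaRowIso (fun i k j h => by
    subst h
    exact L.d_zero i j) j

/-- The components of order one of the differential, with a free index for the target. -/
lemma d_app_eq (L : ThetaLift X) {δ₁ : ∀ j : ℤ, row X j ⟶ row X (j + 1)}
    (h : ∀ i j : ℤ, (L.d i (i + 1)).app j (j + 1) = thetaD₁ δ₁ i j) (i i' j : ℤ) (hi : i + 1 = i') :
    (L.d i i').app j (j + 1) = i.negOnePow • ((δ₁ j).f (i - j) ≫
      ((row X (j + 1)).XIsoOfEq (show i - j = i' - (j + 1) by omega)).hom) := by
  subst hi
  exact h i j

/-- The sign `(-1)^i` of `thetaD₁` cancels against that of `rowD`. -/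
lemma rowIso_comp_δ₁ (L : ThetaLift X) {δ₁ : ∀ j : ℤ, row X j ⟶ row X (j + 1)}
    (h : ∀ i j : ℤ, (L.d i (i + 1)).app j (j + 1) = thetaD₁ δ₁ i j) (j : ℤ) :
    (L.rowIso j).hom ≫ δ₁ j = rowD L.cplx j (j + 1) rfl ≫ (L.rowIso (j + 1)).hom := by
  refine HomologicalComplex.hom_ext _ _ (fun p => ?_)
  change ((row X j).XIsoOfEq (show p + j - j = p by omega)).hom ≫ (δ₁ j).f p =
    ((p + j).negOnePow • (L.d (p + j) (p + (j + 1))).app j (j + 1)) ≫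
      ((row X (j + 1)).XIsoOfEq (show p + (j + 1) - (j + 1) = p by omega)).hom
  have e : ((row X j).XIsoOfEq (show p + j - j = p by omega)).hom ≫ (δ₁ j).f p =
      ((p + j).negOnePow • (p + j).negOnePow • ((δ₁ j).f (p + j - j) ≫ ((row X (j + 1)).XIsoOfEq
        (show p + j - j = p + (j + 1) - (j + 1) by omega)).hom)) ≫
      ((row X (j + 1)).XIsoOfEq (show p + (j + 1) - (j + 1) = p by omega)).hom := by
    rw [smul_smul, Int.units_mul_self, one_smul, Category.assoc,
      HomologicalComplex.XIsoOfEq_hom_comp_XIsoOfEq_hom,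
      HomologicalComplex.XIsoOfEq_hom_naturality]
  refine e.trans (congrArg (fun x : (row X j).X (p + j - j) ⟶
    (row X (j + 1)).X (p + (j + 1) - (j + 1)) => ((p + j).negOnePow • x) ≫
      ((row X (j + 1)).XIsoOfEq (show p + (j + 1) - (j + 1) = p by omega)).hom) ?_)
  exact (L.d_app_eq h _ _ _ (by omega)).symm

/-- A lift is a realization. -/
def realization (L : ThetaLift X) : Realization X L.cplx where
  iso j := (toKProj Λ).mapIso (L.rowIso j)
  comm j k h := by
    subst h
    obtain ⟨δ₁, hδ₁, hd⟩ := L.d_one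
    rw [← hδ₁ j]
    exact ((toKProj Λ).map_comp _ _).symm.trans ((congrArg (toKProj Λ).map
      (L.rowIso_comp_δ₁ hd j)).trans ((toKProj Λ).map_comp _ _))

end ThetaLift

/-- The components `f_0` of a chain map between lifts, as maps between the rows of `X` and `Y`. -/
lemma rowMap_eq_iff {X Y : CochainComplex (SumCat T) ℤ} (LX : ThetaLift X) (LY : ThetaLift Y)
    (f : LX.cplx ⟶ LY.cplx) (j : ℤ) (a : row X j ⟶ row Y j) :
    rowMap f j = (LX.rowIso j).hom ≫ a ≫ (LY.rowIso j).inv ↔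
      ∀ i : ℤ, (f.f i).app j j = a.f (i - j) := by
  have e : ∀ p : ℤ, ((LX.rowIso j).hom ≫ a ≫ (LY.rowIso j).inv).f p = a.f (p + j - j) := fun p => by
    have e' : ((row X j).XIsoOfEq (show p + j - j = p by omega)).hom ≫ a.f p ≫
        ((row Y j).XIsoOfEq (show p + j - j = p by omega)).inv = a.f (p + j - j) := by
      rw [HomologicalComplex.XIsoOfEq_inv_naturality,
        HomologicalComplex.XIsoOfEq_hom_comp_XIsoOfEq_inv_assoc]
      exact Category.id_comp _
    exact e'
  constructor
  · intro h i
    obtain ⟨p, rfl⟩ : ∃ p, i = p + j := ⟨i - j, by omega⟩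
    exact (congrArg (fun g : grRow LX.cplx j ⟶ grRow LY.cplx j => g.f p) h).trans (e p)
  · intro h
    exact HomologicalComplex.hom_ext _ _ (fun p => (h (p + j)).trans (e p).symm)

lemma IsThetaLift.isLift {X Y : CochainComplex (SumCat T) ℤ} {LX : ThetaLift X} {LY : ThetaLift Y}
    {α : X ⟶ Y} {f : LX.cplx ⟶ LY.cplx} (h : IsThetaLift LX LY α f) :
    IsLift LX.realization LY.realization α f := fun j => by
  obtain ⟨a, ha, hf⟩ := h
  have h := (rowMap_eq_iff LX LY f j (a j)).2 (fun i => hf i j)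
  rw [← Category.assoc, Iso.eq_comp_inv] at h
  refine ((toKProj Λ).map_comp _ _).symm.trans ((congrArg (toKProj Λ).map h).trans
    (((toKProj Λ).map_comp _ _).trans ?_))
  rw [ha]
  rfl

lemma exists_thetaLift_map (hT : IsTiltingComplex T) {X Y : CochainComplex (SumCat T) ℤ}
    (LX : ThetaLift X) (LY : ThetaLift Y) (α : X ⟶ Y) (a : ∀ j : ℤ, row X j ⟶ row Y j)
    (ha : ∀ j, Represents (a j) (α.f j)) :
    ∃ f : LX.cplx ⟶ LY.cplx, ∀ i j : ℤ, (f.f i).app j j = (a j).f (i - j) := by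
  obtain ⟨f, hf⟩ := exists_rowMap_eq_of_realization LX.realization LY.realization hT α
    (fun j => (LX.rowIso j).hom ≫ a j ≫ (LY.rowIso j).inv) (fun j => by
      have h : ((LX.rowIso j).hom ≫ a j ≫ (LY.rowIso j).inv) ≫ (LY.rowIso j).hom =
        (LX.rowIso j).hom ≫ a j := by simp
      rw [← ha j]
      exact ((toKProj Λ).map_comp _ _).symm.trans ((congrArg (toKProj Λ).map h).trans
        ((toKProj Λ).map_comp _ _)))
  exact ⟨f, fun i j => (rowMap_eq_iff LX LY f j (a j)).1 (hf j) i⟩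

/-- A perturbation of `δ_0` of vanishing curvature whose part of order one is `(-1)^i δ_1` defines a
lift. -/
lemma exists_thetaLift_of_perturbation {X : CochainComplex (SumCat T) ℤ}
    {δ₁ : ∀ j : ℤ, row X j ⟶ row X (j + 1)} (hδ₁ : ∀ j, Represents (δ₁ j) (X.d j (j + 1)))
    {E : Cochain (thetaBase X) (thetaBase X) 1} (hE : FiltGE 1 E) (hE₀ : curvature E = 0)
    (hE₁ : ∀ (i i' j : ℤ) (hi : i + 1 = i'), (E.v i i' hi).app j (j + 1) =
      i.negOnePow • ((δ₁ j).f (i - j) ≫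
        ((row X (j + 1)).XIsoOfEq (show i - j = i' - (j + 1) by omega)).hom)) :
    ∃ L : ThetaLift X, ∀ i j : ℤ, (L.d i (i + 1)).app j (j + 1) = thetaD₁ δ₁ i j := by
  obtain ⟨d₀, hd₀⟩ : ∃ d₀ : ∀ i k : ℤ, thetaObj X i ⟶ thetaObj X k, d₀ = (thetaBase X).d :=
    ⟨_, rfl⟩
  obtain ⟨F, hF, hF₀⟩ : ∃ F : ∀ i k : ℤ, thetaObj X i ⟶ thetaObj X k,
      (∀ i, F i (i + 1) = E.v i (i + 1) rfl) ∧ ∀ i k, i + 1 ≠ k → F i k = 0 :=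
    ⟨fun i k => if h : i + 1 = k then E.v i k h else 0, fun i => dif_pos rfl,
      fun i k h => dif_neg h⟩
  have hD₁ : ∀ i j : ℤ, (d₀ i (i + 1) + F i (i + 1)).app j (j + 1) = thetaD₁ δ₁ i j := by
    intro i j
    rw [Gr.add_app, hF, hd₀]
    exact (congrArg₂ (· + ·) (thetaBase_d_app_ne X i (i + 1) j (j + 1) (by omega))
      (hE₁ i (i + 1) j rfl)).trans (zero_add _)
  have hdd : ∀ i, d₀ i (i + 1) ≫ d₀ (i + 1) (i + 1 + 1) = 0 := fun i => by
    rw [hd₀]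
    exact (thetaBase X).d_comp_d i (i + 1) (i + 1 + 1)
  have hdF : ∀ i, F i (i + 1) ≫ d₀ (i + 1) (i + 1 + 1) + d₀ i (i + 1) ≫ F (i + 1) (i + 1 + 1) +
      F i (i + 1) ≫ F (i + 1) (i + 1 + 1) = 0 := fun i => by
    have h := Cochain.congr_v hE₀ i (i + 1 + 1) (by ring)
    rw [curvature, Cochain.add_v, δ_v 1 2 rfl E i (i + 1 + 1) (by ring) (i + 1) (i + 1) (by ring)
      rfl, Cochain.comp_v _ _ _ i (i + 1) (i + 1 + 1) rfl rfl,
      Int.negOnePow_even 2 (by decide), one_smul] at h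
    rw [hF, hF, hd₀]
    exact h
  refine ⟨
    { d := fun i k => d₀ i k + F i k
      shape := fun i k h => by
        rw [hF₀ _ _ h, add_zero, hd₀]
        exact (thetaBase X).shape _ _ h
      d_comp_d := fun i => ?_
      d_zero := fun i j => ?_
      d_one := ⟨δ₁, hδ₁, hD₁⟩ }, hD₁⟩
  · rw [Preadditive.add_comp, Preadditive.comp_add, Preadditive.comp_add, hdd, zero_add,
      ← hdF i]
    abel
  · rw [Gr.add_app, hF, hd₀]
    exact (congrArg₂ (· + ·) (thetaBase_d_app_self X i (i + 1) j)
      (hE _ _ _ _ _ (by omega))).trans (add_zero _)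

/-- Every object has a lift: the differential `δ_0 + δ_1 + ⋯` is found by solving the
Maurer-Cartan equation order by order. -/
lemma exists_thetaLift (hT : IsTiltingComplex T) (X : CochainComplex (SumCat T) ℤ)
    (δ₁ : ∀ j : ℤ, row X j ⟶ row X (j + 1)) (hδ₁ : ∀ j, Represents (δ₁ j) (X.d j (j + 1))) :
    ∃ L : ThetaLift X, ∀ i j : ℤ, (L.d i (i + 1)).app j (j + 1) = thetaD₁ δ₁ i j := by
  have hδδ : ∀ j, Nonempty (Homotopy (δ₁ j ≫ δ₁ (j + 1)) 0) := fun j =>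
    ⟨HomotopyCategory.homotopyOfEq _ _ (by
      refine ((toKProj Λ).map_comp _ _).trans (Eq.trans ?_ ((toKProj Λ).map_zero _ _).symm)
      rw [hδ₁, hδ₁]
      exact congrArg (fun x => x.hom) (X.d_comp_d j (j + 1) (j + 1 + 1)))⟩
  have H : OrthogonalRows (thetaBase X) (thetaBase X) := fun j k r hr =>
    isAcyclicHom_of_isSum hT (X.X j).property (X.X k).property
      ((toKProj Λ).mapIso (thetaBaseRowIso X j)) ((toKProj Λ).mapIso (thetaBaseRowIso X k)) r hr
  obtain ⟨E, hE, hEc, hE₀⟩ := exists_curvature_eq_zero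
    (fun p q j k h => thetaBase_d_app_ne X p q j k h) H
    (fun j k h => (thetaBaseRowIso X j).hom ≫ δ₁ j ≫ eqToHom (by rw [h]) ≫
      (thetaBaseRowIso X k).inv) (by
      rintro j _ _ rfl rfl
      obtain ⟨h⟩ := hδδ j
      refine ⟨(Homotopy.ofEq ?_).trans ((((h.compRight (thetaBaseRowIso X (j + 1 + 1)).inv).compLeft
        (thetaBaseRowIso X j).hom).trans (Homotopy.ofEq (by simp))))⟩
      simp)
  have hE₁ : ∀ (i i' j : ℤ) (hi : i + 1 = i'), (E.v i i' hi).app j (j + 1) =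
      i.negOnePow • ((δ₁ j).f (i - j) ≫
        ((row X (j + 1)).XIsoOfEq (show i - j = i' - (j + 1) by omega)).hom) := by
    intro i i' j hi
    obtain ⟨p, rfl⟩ : ∃ p, i = p + j := ⟨i - j, by omega⟩
    obtain rfl : i' = p + (j + 1) := by omega
    have h := Cochain.congr_v (hEc j (j + 1) rfl) p p (add_zero p)
    rw [rowCochain_v, Cochain.ofHom_v, eqToHom_refl, Category.id_comp, add_sub_cancel_left,
      mul_one] at h
    have e : ((row X j).XIsoOfEq (show p + j - j = p by omega)).hom ≫ (δ₁ j).f p ≫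
        ((row X (j + 1)).XIsoOfEq (show p + (j + 1) - (j + 1) = p by omega)).inv =
        (δ₁ j).f (p + j - j) ≫ ((row X (j + 1)).XIsoOfEq
          (show p + j - j = p + (j + 1) - (j + 1) by omega)).hom := by
      rw [← HomologicalComplex.XIsoOfEq_hom_naturality_assoc,
        HomologicalComplex.XIsoOfEq_hom_comp_XIsoOfEq_inv]
    have h' := congrArg ((p + j).negOnePow • ·) (h.trans e)
    dsimp only at h'
    rw [smul_smul, Int.units_mul_self, one_smul] at h'
    exact h'
  exact exists_thetaLift_of_perturbation hδ₁ hE hE₀ hE₁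

end Lifts

/-! ### The triangle functor -/

section StableRealizations

variable {Λ : Type u} [Ring Λ] {T : CochainComplex (ProjMod Λ) ℤ}
  {X Y Z : CochainComplex (SumCat T) ℤ} {U V W : CochainComplex (Gr (ProjMod Λ)) ℤ}
  {e : Realization X U} {e' : Realization Y V}

lemma IsLift.toKEta_map_eq (hT : IsTiltingComplex T) {α : X ⟶ Y} {f g : U ⟶ V}
    (hf : IsLift e e' α f) (hg : IsLift e e' α g) :
    (grTwist Λ).toKEta.map f = (grTwist Λ).toKEta.map g :=
  ((grTwist Λ).toKEta_map_eq_iff f g).2 (hf.etaHomotopic hT hg (Homotopy.refl α))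

/-- The canonical isomorphism in `K_η(gr Proj Λ)` between two realizations of a complex. -/
def realizationIso (hT : IsTiltingComplex T) (e : Realization X U) (e' : Realization X V) :
    (grTwist Λ).toKEta.obj U ≅ (grTwist Λ).toKEta.obj V where
  hom := (grTwist Λ).toKEta.map (exists_isLift e e' hT (𝟙 X)).choose
  inv := (grTwist Λ).toKEta.map (exists_isLift e' e hT (𝟙 X)).choose
  hom_inv_id := by
    have h := (exists_isLift e e' hT (𝟙 X)).choose_spec.comp
      (exists_isLift e' e hT (𝟙 X)).choose_spec
    rw [Category.comp_id] at h
    rw [← Functor.map_comp, h.toKEta_map_eq hT (IsLift.id e), CategoryTheory.Functor.map_id]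
  inv_hom_id := by
    have h := (exists_isLift e' e hT (𝟙 X)).choose_spec.comp
      (exists_isLift e e' hT (𝟙 X)).choose_spec
    rw [Category.comp_id] at h
    rw [← Functor.map_comp, h.toKEta_map_eq hT (IsLift.id e'), CategoryTheory.Functor.map_id]

lemma IsLift.comp_realizationIso (hT : IsTiltingComplex T) {e'' : Realization Y W} {α : X ⟶ Y}
    {f : U ⟶ V} {g : U ⟶ W} (hf : IsLift e e' α f) (hg : IsLift e e'' α g) :
    (grTwist Λ).toKEta.map f ≫ (realizationIso hT e' e'').hom = (grTwist Λ).toKEta.map g := by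
  have h := hf.comp (exists_isLift e' e'' hT (𝟙 Y)).choose_spec
  rw [Category.comp_id] at h
  exact ((grTwist Λ).toKEta.map_comp _ _).symm.trans (h.toKEta_map_eq hT hg)

lemma IsLift.realizationIso_comp (hT : IsTiltingComplex T) {e'' : Realization X W} {α : X ⟶ Y}
    {f : U ⟶ V} {g : W ⟶ V} (hf : IsLift e e' α f) (hg : IsLift e'' e' α g) :
    (realizationIso hT e'' e).hom ≫ (grTwist Λ).toKEta.map f = (grTwist Λ).toKEta.map g := by
  have h := (exists_isLift e'' e hT (𝟙 X)).choose_spec.comp hf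
  rw [Category.id_comp] at h
  exact ((grTwist Λ).toKEta.map_comp _ _).symm.trans (h.toKEta_map_eq hT hg)

end StableRealizations

section ThetaFunctor

variable {Λ : Type u} [Ring Λ] {T : CochainComplex (ProjMod Λ) ℤ}

namespace Theta

variable (Θ : Theta T)

/-- `Θ(X)` as a realization of `X`. -/
def realization (X : CochainComplex (SumCat T) ℤ) : Realization X (Θ.obj X).cplx :=
  (Θ.obj X).realization

lemma isLift_map {X Y : CochainComplex (SumCat T) ℤ} (α : X ⟶ Y) :
    IsLift (Θ.realization X) (Θ.realization Y) α (Θ.map α) :=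
  (Θ.isThetaLift_map α).isLift

lemma inducesFunctor (hT : IsTiltingComplex T) : Θ.InducesFunctor where
  map_homotopic α β h := (Θ.isLift_map α).etaHomotopic hT (Θ.isLift_map β) h
  map_id X := (Θ.isLift_map (𝟙 X)).etaHomotopic hT (IsLift.id _) (Homotopy.refl _)
  map_comp α β := (Θ.isLift_map (α ≫ β)).etaHomotopic hT
    ((Θ.isLift_map α).comp (Θ.isLift_map β)) (Homotopy.refl _)

lemma functor_map (h : Θ.InducesFunctor) {X Y : CochainComplex (SumCat T) ℤ} (α : X ⟶ Y) :
    (Θ.functor h).map ((toKSum T).map α) = (grTwist Λ).toKEta.map (Θ.map α) := rfl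

lemma functor_additive (hT : IsTiltingComplex T) (h : Θ.InducesFunctor) : (Θ.functor h).Additive where
  map_add {X Y f g} := by
    obtain ⟨α, rfl⟩ := (toKSum T).map_surjective (X := X.as) (Y := Y.as) f
    obtain ⟨β, rfl⟩ := (toKSum T).map_surjective (X := X.as) (Y := Y.as) g
    exact (Θ.isLift_map (α + β)).toKEta_map_eq hT ((Θ.isLift_map α).add (Θ.isLift_map β))

variable (hT : IsTiltingComplex T)

/-- The isomorphism `Θ(X[1]) ≅ Θ(X)(1)[1]`, where both sides realize `X[1]`. -/
def translationIso (h : Θ.InducesFunctor) (X : CochainComplex (SumCat T) ℤ) :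
    (Θ.functor h).obj ((CategoryTheory.shiftFunctor (KSum T) (1 : ℤ)).obj ((toKSum T).obj X)) ≅
      (grTwist Λ).translation.obj ((Θ.functor h).obj ((toKSum T).obj X)) :=
  (Θ.functor h).mapIso (((toKSum T).commShiftIso (1 : ℤ)).symm.app X) ≪≫
    realizationIso hT (Θ.realization _) (Θ.realization X).translation

/-- Both sides are classes of lifts of `α[1]`. -/
lemma translationIso_naturality (h : Θ.InducesFunctor) {X Y : CochainComplex (SumCat T) ℤ}
    (α : X ⟶ Y) :
    (Θ.functor h).map ((CategoryTheory.shiftFunctor (KSum T) (1 : ℤ)).map ((toKSum T).map α)) ≫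
        (Θ.translationIso hT h Y).hom =
      (Θ.translationIso hT h X).hom ≫
        (grTwist Λ).translation.map ((Θ.functor h).map ((toKSum T).map α)) := by
  obtain ⟨g, hg⟩ := exists_isLift
    (Θ.realization ((CategoryTheory.shiftFunctor (CochainComplex (SumCat T) ℤ) (1 : ℤ)).obj X))
    (Θ.realization Y).translation hT ((CategoryTheory.shiftFunctor _ (1 : ℤ)).map α)
  have h₁ : (Θ.functor h).map ((toKSum T).map ((CategoryTheory.shiftFunctor _ (1 : ℤ)).map α)) ≫
        (realizationIso hT (Θ.realization _) (Θ.realization Y).translation).hom =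
      (realizationIso hT (Θ.realization _) (Θ.realization X).translation).hom ≫
        (grTwist Λ).translation.map ((Θ.functor h).map ((toKSum T).map α)) :=
    ((Θ.isLift_map _).comp_realizationIso hT hg).trans
      ((Θ.isLift_map α).translation.realizationIso_comp hT hg).symm
  have h₂ := congrArg (Θ.functor h).map (((toKSum T).commShiftIso (1 : ℤ)).inv.naturality α)
  exact (Category.assoc _ _ _).symm.trans ((congrArg (· ≫ _)
    (((Θ.functor h).map_comp _ _).symm.trans (h₂.trans ((Θ.functor h).map_comp _ _)))).trans
    ((Category.assoc _ _ _).trans ((congrArg (_ ≫ ·) h₁).trans (Category.assoc _ _ _).symm)))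

/-- The natural isomorphism `ξ : Θ(X[1]) ≅ Θ(X)(1)[1]` on `K(Sum T)`. -/
def shiftIso (h : Θ.InducesFunctor) :
    CategoryTheory.shiftFunctor (KSum T) (1 : ℤ) ⋙ Θ.functor h ≅
      Θ.functor h ⋙ (grTwist Λ).translation :=
  NatIso.ofComponents (fun X => Θ.translationIso hT h X.as) (fun {X Y} f => by
    obtain ⟨α, rfl⟩ := (toKSum T).map_surjective (X := X.as) (Y := Y.as) f
    exact Θ.translationIso_naturality hT h α)

/-- The isomorphism `Θ(cone(α)) ≅ cone(Θ(α) η)`, where both sides realize `cone(α)`. -/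
def coneIso (h : Θ.InducesFunctor) {X Y : CochainComplex (SumCat T) ℤ} (α : X ⟶ Y) :
    (Θ.functor h).obj ((toKSum T).obj (mappingCone α)) ≅
      (grTwist Λ).toKEta.obj (etaCone (Θ.map α)) :=
  realizationIso hT (Θ.realization _) (Θ.isLift_map α).cone

/-- Both sides are classes of lifts of the inclusion `Y ⟶ cone(α)`. -/
lemma map_mor₂_comp_coneIso (h : Θ.InducesFunctor) {X Y : CochainComplex (SumCat T) ℤ}
    (α : X ⟶ Y) :
    (Θ.functor h).map (mappingCone.triangleh α).mor₂ ≫ (Θ.coneIso hT h α).hom =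
      (grTwist Λ).toKEta.map (etaConeInr (Θ.map α)) :=
  (Θ.isLift_map (mappingCone.inr α)).comp_realizationIso hT (Θ.isLift_map α).inr_cone

/-- Both sides are classes of lifts of the projection `cone(α) ⟶ X[1]`. -/
lemma map_mor₃_comp_shiftIso (h : Θ.InducesFunctor) {X Y : CochainComplex (SumCat T) ℤ}
    (α : X ⟶ Y) :
    (Θ.functor h).map (mappingCone.triangleh α).mor₃ ≫
        (Θ.shiftIso hT h).hom.app ((toKSum T).obj X) =
      (Θ.coneIso hT h α).hom ≫ (grTwist Λ).standardMor₃ (Θ.map α) := by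
  obtain ⟨g, hg⟩ := exists_isLift (Θ.realization (mappingCone α)) (Θ.realization X).translation hT
    (mappingCone.triangle α).mor₃
  have h₁ := (Θ.isLift_map (mappingCone.triangle α).mor₃).comp_realizationIso hT hg
  have h₂ := (Θ.isLift_map α).cone_δ.realizationIso_comp hT hg
  refine Eq.trans ?_ (h₁.trans h₂.symm)
  have h₃ : (mappingCone.triangleh α).mor₃ ≫ ((toKSum T).commShiftIso (1 : ℤ)).inv.app X =
      (toKSum T).map (mappingCone.triangle α).mor₃ :=
    (Category.assoc _ _ _).trans ((congrArg (_ ≫ ·)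
      (((toKSum T).commShiftIso (1 : ℤ)).hom_inv_id_app X)).trans (Category.comp_id _))
  exact (Category.assoc _ _ _).symm.trans (congrArg (· ≫ _)
    (((Θ.functor h).map_comp _ _).symm.trans (congrArg (Θ.functor h).map h₃)))

/-- Each triangle is isomorphic to the standard triangle of a chain map, whose image is standard. -/
lemma isTriangleFunctor (h : Θ.InducesFunctor) :
    IsTriangleFunctor (grTwist Λ) (Θ.functor h) (Θ.shiftIso hT h) where
  additive := Θ.functor_additive hT h
  map_triangle t ht := by
    obtain ⟨X, Y, α, ⟨φ⟩⟩ := ht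
    have h₁ := φ.hom.comm₁
    have h₂ := φ.hom.comm₂
    have h₃ := φ.hom.comm₃
    refine ⟨_, _, Θ.map α, (Θ.functor h).mapIso (Pretriangulated.Triangle.π₁.mapIso φ),
      (Θ.functor h).mapIso (Pretriangulated.Triangle.π₂.mapIso φ),
      (Θ.functor h).mapIso (Pretriangulated.Triangle.π₃.mapIso φ) ≪≫ Θ.coneIso hT h α, ?_, ?_, ?_⟩
    · refine ((Θ.functor h).map_comp _ _).symm.trans ((congrArg (Θ.functor h).map h₁).trans
        ((Θ.functor h).map_comp _ _))
    · exact (Category.assoc _ _ _).symm.trans ((congrArg (· ≫ _) (((Θ.functor h).map_comp _ _).symm.trans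
        ((congrArg (Θ.functor h).map h₂).trans ((Θ.functor h).map_comp _ _)))).trans
        ((Category.assoc _ _ _).trans (congrArg (_ ≫ ·) (Θ.map_mor₂_comp_coneIso hT h α))))
    · have h₄ := (Θ.shiftIso hT h).hom.naturality φ.hom.hom₁
      refine (Category.assoc _ _ _).trans ((congrArg (_ ≫ ·) h₄.symm).trans
        ((Category.assoc _ _ _).symm.trans ((congrArg (· ≫ _) (((Θ.functor h).map_comp _ _).symm.trans
          ((congrArg (Θ.functor h).map h₃).trans ((Θ.functor h).map_comp _ _)))).trans
        ((Category.assoc _ _ _).trans ((congrArg (_ ≫ ·) (Θ.map_mor₃_comp_shiftIso hT h α)).trans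
          (Category.assoc _ _ _).symm)))))

end Theta

end ThetaFunctor

end

end RickardTheta


theorem mainTheorem7 {Λ : Type u} [Ring Λ] (T : CochainComplex (ProjMod Λ) ℤ)
    (hT : IsTiltingComplex T) :
    -- every object of `C(Sum T)` has a lift, for any choice of representatives of its differential
    (∀ (X : CochainComplex (SumCat T) ℤ) (δ₁ : ∀ j : ℤ, row X j ⟶ row X (j + 1)),
      (∀ j, Represents (δ₁ j) (X.d j (j + 1))) →
        ∃ L : ThetaLift X, ∀ i j : ℤ, (L.d i (i + 1)).app j (j + 1) = thetaD₁ δ₁ i j) ∧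
    -- every morphism of `C(Sum T)` has a lift, for any choice of representatives of its components
    (∀ (X Y : CochainComplex (SumCat T) ℤ) (LX : ThetaLift X) (LY : ThetaLift Y) (α : X ⟶ Y)
      (a : ∀ j : ℤ, row X j ⟶ row Y j), (∀ j, Represents (a j) (α.f j)) →
        ∃ f : LX.cplx ⟶ LY.cplx, ∀ i j : ℤ, (f.f i).app j j = (a j).f (i - j)) ∧
    -- lifts of homotopic morphisms are `η`-homotopic
    (∀ (X Y : CochainComplex (SumCat T) ℤ) (LX : ThetaLift X) (LY : ThetaLift Y) (α β : X ⟶ Y)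
      (f g : LX.cplx ⟶ LY.cplx), Homotopy α β →
        IsThetaLift LX LY α f → IsThetaLift LX LY β g → (grTwist Λ).EtaHomotopic f g) ∧
    -- every choice `Θ` of lifts induces a triangle functor, which preserves standard triangles
    (∀ Θ : Theta T, ∃ (h : Θ.InducesFunctor)
      (ξ : shiftFunctor (KSum T) (1 : ℤ) ⋙ Θ.functor h ≅
        Θ.functor h ⋙ (grTwist Λ).translation),
      IsTriangleFunctor (grTwist Λ) (Θ.functor h) ξ ∧
      ∀ (X Y : CochainComplex (SumCat T) ℤ) (α : X ⟶ Y),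
        ∃ e : (Θ.functor h).obj ((toKSum T).obj (mappingCone α)) ≅
            (grTwist Λ).toKEta.obj
              (mappingCone ((grTwist Λ).ηCplx.app (Θ.obj X).cplx ≫ Θ.map α)),
          (Θ.functor h).map ((toKSum T).map α) = (grTwist Λ).toKEta.map (Θ.map α) ∧
          (Θ.functor h).map (mappingCone.triangleh α).mor₂ ≫ e.hom =
            (grTwist Λ).toKEta.map
              (mappingCone.inr ((grTwist Λ).ηCplx.app (Θ.obj X).cplx ≫ Θ.map α)) ∧
          (Θ.functor h).map (mappingCone.triangleh α).mor₃ ≫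
              ξ.hom.app ((toKSum T).obj X) =
            e.hom ≫ (grTwist Λ).standardMor₃ (Θ.map α)) := by
  refine ⟨exists_thetaLift hT, fun X Y LX LY α a ha => exists_thetaLift_map hT LX LY α a ha,
    fun X Y LX LY α β f g h hf hg => hf.isLift.etaHomotopic hT hg.isLift h, fun Θ => ?_⟩
  have h := Θ.inducesFunctor hT
  exact ⟨h, Θ.shiftIso hT h, Θ.isTriangleFunctor hT h, fun X Y α => ⟨Θ.coneIso hT h α,
    Θ.functor_map h α, Θ.map_mor₂_comp_coneIso hT h α, Θ.map_mor₃_comp_shiftIso hT h α⟩⟩
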